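/- Let $n\in\mathbb N$ and write points of $\mathbb R^{n(n+1)/2}$ as triangular arrays $y=(y^1,\dots,y^n)$ with $y^k=(y^k_1,\dots,y^k_k)$. **Continuous side.** For $x\in\mathbb R^{k+1}$, $y\in\mathbb R^{k}$ write $x\succeq y$ if $x_1\le y_1\le x_2\le\cdots\le y_k\le x_{k+1}$. The Gelfand–Tsetlin cone $GT^n$ is the set of arrays $y$ with $y^{k+1}\succeq y^k$ for $1\le k\le n-1$. For $x_1\le\cdots\le x_n$ let $GT_n(x)=\{y\in GT^n: y^n=x\}$, a bounded convex set, and let $\mathbb E^{x}$ be the expectation with respect to the uniform probability measure on $GT_n(x)$, that is, Lebesgue measure on the affine span of $GT_n(x)$ restricted to $GT_n(x)$ and normalized (a point mass if the span is a point). A probability measure $\mu$ on $GT^n$ has the *continuous Gibbs property* if, conditionally on $y^n$, the array is uniform on $GT_n(y^n)$, i.e. for every bounded continuous $f:\mathbb R^{n(n+1)/2}\to\mathbb C$ the function $x\mapsto\mathbb E^{x}[f(y)]$ is integrable with respect to the law $\mu^n$ of $y^n$ under $\mu$, and $$\mathbb E^{\mu}[f(y)]=\int \mathbb E^{x}[f(y)]\,\mu^n(dx).$$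 **Discrete side.** Let $\mathsf{GT}^{n+}$ be the set of half-strict Gelfand–Tsetlin patterns with nonnegative top row, i.e. of integer arrays $m=(m^1,\dots,m^n)$ with $m^k_1<\cdots<m^k_k$ for $1\le k\le n$, $m^{k+1}\succeq m^k$ for $1\le k\le n-1$, and $m^n_1\ge0$. Let $\mathcal P_n$ be the set of configurations $\omega$ of $n$ up-right lattice paths in $D_n=\mathbb Z_{\ge0}\times\{1,\dots,n\}$, no two sharing an edge, such that one path enters each point $(0,j)$, $1\le j\le n$, from the left, no path enters from below, and all paths exit through the top. The map $h:\mathcal P_n\to\mathsf{GT}^{n+}$, for which $m^k_1<\cdots<m^k_k$ are the $x$-coordinates of the intersections of $\omega$ with the line $y=k+\tfrac12$, is a bijection; put $\mathcal P_n^\lambda=h^{-1}(\{m: m^n=\lambda\})$. At each vertex the arrow configuration $(i_1,j_1;i_2,j_2)$ records the numbers of arrows entering from the bottom and from the left and leaving to the top and to the right. For fixed $w_1,\dots,w_6>0$ put $$w(0,0;0,0)=w_1,\quad w(1,1;1,1)=w_2,\quad w(1,0;1,0)=w_3,\quad w(0,1;0,1)=w_4,\quad w(1,0;0,1)=w_5,\quad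 w(0,1;1,0)=w_6 .$$ A probability measure $\nu$ on $\mathcal P_n^\lambda$ has the *Gibbs property* with these weights if for every finite $\Lambda\subset D_n$ the conditional probability of $\omega\in\mathcal P_n^\lambda$, given the arrow configurations at the vertices of $D_n\setminus\Lambda$, is proportional to $\prod_{v\in\Lambda}w(\omega(v))$. A probability measure $\rho$ on $\mathsf{GT}^{n+}$ has the *six-vertex Gibbs property* with weights $(w_1,\dots,w_6)$ if for every $\lambda$ with $\rho(m^n=\lambda)>0$ the image under $h^{-1}$ of $\rho(\,\cdot\mid m^n=\lambda)$ has the Gibbs property on $\mathcal P^\lambda_n$ with these weights. **Proposition 6.5.** Fix $w_1,\dots,w_6>0$ and $n\in\mathbb N$. Let $\rho(k)$, $k\in\mathbb N$, be probability measures on $\mathsf{GT}^{n+}$ that have the six-vertex Gibbs property with weights $(w_1,\dots,w_6)$, and let $a(k),b(k)$ be real sequences with $b(k)\to\infty$. Put $$g_k(x)=\frac{1}{b(k)}\bigl(x-a(k)\cdot\mathbf 1\bigr),\qquad x\in\mathbb R^{n(n+1)/2},$$ where $\mathbf 1$ is the vector of ones, and suppose that $\rho(k)\circ g_k^{-1}$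 converges weakly to a probability measure $\mu$ on $GT^n$ such that $$\mu\bigl(y^n_i=y^n_{i+1}=y^n_{i+2}\text{ for some }1\le i\le n-2\bigr)=0 .$$ Then $\mu$ has the continuous Gibbs property. -/

import Mathlib

open MeasureTheory ProbabilityTheory Filter Topology
open scoped BoundedContinuousFunction

namespace SixVertexGT

/-! ### Triangular arrays and interlacing -/

/-- Index set of triangular arrays with `n` rows: the `j`-th row (`j = 0, …, n - 1`) has `j + 1`
entries.  It has `n (n + 1) / 2` elements, so `GTIndex n → ℝ` is `ℝ^{n(n+1)/2}`. -/
abbrev GTIndex (n : ℕ) : Type := (j : Fin n) × Fin (j.val + 1)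

/-- The row of size `k`, `y^k = (y^k_1, …, y^k_k)`, of a triangular array. -/
def row {α : Type*} {n : ℕ} (y : GTIndex n → α) (k : ℕ) (hk : k ≤ n) : Fin k → α := fun i =>
  y ⟨⟨k - 1, by have := i.isLt; omega⟩, ⟨i.val, by have := i.isLt; simp only; omega⟩⟩

/-- The top row `y^n` of a triangular array with `n` rows. -/
def topRow {α : Type*} {n : ℕ} (y : GTIndex n → α) : Fin n → α := row y n le_rfl

/-- `x ⪰ y`, that is `x_1 ≤ y_1 ≤ x_2 ≤ y_2 ≤ ⋯ ≤ y_k ≤ x_{k+1}`. -/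
def Interlace {α : Type*} [LE α] {k : ℕ} (x : Fin (k + 1) → α) (y : Fin k → α) : Prop :=
  ∀ i : Fin k, x i.castSucc ≤ y i ∧ y i ≤ x i.succ

/-! ### The Gelfand-Tsetlin cone and the continuous Gibbs property -/

/-- The Gelfand-Tsetlin cone `GT^n` in `ℝ^{n(n+1)/2}`. -/
def gtCone (n : ℕ) : Set (GTIndex n → ℝ) :=
  {y | ∀ (k : ℕ) (hk : k + 1 ≤ n), Interlace (row y (k + 1) hk) (row y k (by omega))}

/-- The Gelfand-Tsetlin polytope `GT_n(x)` of all patterns with top row `x`. -/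
def gtPolytope {n : ℕ} (x : Fin n → ℝ) : Set (GTIndex n → ℝ) :=
  {y | y ∈ gtCone n ∧ topRow y = x}

/-- The uniform probability measure on a bounded convex set `C` containing `p`: Lebesgue measure on
the affine span `p + vectorSpan ℝ C` of `C`, restricted to `C` and normalized.  Lebesgue measure on
the direction `vectorSpan ℝ C` is taken as a Haar measure (a point mass in dimension `0`); its
scale cancels in the normalization, and the measure does not depend on `p ∈ C`. -/
noncomputable def uniformOnConvex {E : Type*} [NormedAddCommGroup E] [NormedSpace ℝ E]
    [FiniteDimensional ℝ E] [MeasurableSpace E] [BorelSpace E] (C : Set E) (p : E) : Measure E :=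
  ProbabilityTheory.cond
    (Measure.map (fun v : vectorSpan ℝ C => p + (v : E)) Measure.addHaar) C

/-- The pattern all of whose rows are initial segments of `x`. -/
def basePattern {n : ℕ} (x : Fin n → ℝ) : GTIndex n → ℝ := fun q =>
  x ⟨q.2.val, by have := q.1.isLt; have := q.2.isLt; omega⟩

theorem basePattern_mem {n : ℕ} (x : Fin n → ℝ) (hx : Monotone x) :
    basePattern x ∈ gtPolytope x := by
  refine ⟨fun k hk i => ⟨le_of_eq rfl, hx ?_⟩, funext fun i => rfl⟩
  simp [Fin.le_def]

/-- The uniform probability measure on the polytope `GT_n(x)`, as a measure on `ℝ^{n(n+1)/2}`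
(it is used for weakly increasing `x`; for other `x` the polytope is empty and this is `0`). -/
noncomputable def uniformGT {n : ℕ} (x : Fin n → ℝ) : Measure (GTIndex n → ℝ) :=
  uniformOnConvex (gtPolytope x) (basePattern x)

/-- The continuous Gibbs property: given the top row `y^n`, the pattern is uniform on `GT_n(y^n)`,
i.e. `E^μ[f(y)] = E^{μ^n}[E^{y^n}[f(y)]]` for all bounded continuous `f`, where `μ^n` is the law
of the top row (the outer expectation being that of an integrable function). -/
def ContinuousGibbs {n : ℕ} (μ : Measure (GTIndex n → ℝ)) : Prop :=
  ∀ f : (GTIndex n → ℝ) →ᵇ ℂ,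
    Integrable (fun x : Fin n → ℝ => ∫ y, f y ∂(uniformGT x)) (μ.map topRow) ∧
      ∫ y, f y ∂μ = ∫ x, (∫ y, f y ∂(uniformGT x)) ∂(μ.map topRow)

/-! ### Half-strict Gelfand-Tsetlin patterns -/

/-- `GT^{n+}`: arrays of integers whose rows are strictly increasing and interlace, and whose top
row is nonnegative. -/
structure HalfStrictGT (n : ℕ) where
  entry : GTIndex n → ℤ
  strictMono : ∀ (k : ℕ) (hk : k ≤ n), StrictMono (row entry k hk)
  interlace : ∀ (k : ℕ) (hk : k + 1 ≤ n),
    Interlace (row entry (k + 1) hk) (row entry k (by omega))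
  nonneg : ∀ i : Fin n, 0 ≤ topRow entry i

instance (n : ℕ) : MeasurableSpace (HalfStrictGT n) := ⊤

instance (n : ℕ) : DiscreteMeasurableSpace (HalfStrictGT n) := ⟨fun _ => trivial⟩

theorem HalfStrictGT.row_nonneg {n : ℕ} (m : HalfStrictGT n) (k : ℕ) (hk : k ≤ n) (i : Fin k) :
    0 ≤ row m.entry k hk i := by
  obtain ⟨d, hd⟩ := Nat.exists_eq_add_of_le hk
  induction d generalizing k with
  | zero =>
    obtain rfl : n = k := hd
    exact m.nonneg i
  | succ d ih =>
    exact (ih (k + 1) (by omega) i.castSucc (by omega)).trans (m.interlace k (by omega) i).1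

/-! ### Path configurations of the six-vertex model -/

/-- `P_n`: up-right path configurations on `D_n = ℤ_{≥ 0} × {1, …, n}`, encoded by their edges.
The vertex `(x, j)`, with `j : Fin n`, is the point `(x, j + 1)` of the lattice. -/
@[ext]
structure PathConfig (n : ℕ) where
  /-- `vert x k`: a path uses the vertical edge from `(x, k)` to `(x, k + 1)`. -/
  vert : ℕ → Fin (n + 1) → Bool
  /-- `horiz x j`: a path uses the horizontal edge from `(x - 1, j + 1)` to `(x, j + 1)`. -/
  horiz : ℕ → Fin n → Bool
  /-- At each vertex as many paths leave as enter. -/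
  conserve : ∀ (x : ℕ) (j : Fin n),
    (vert x j.castSucc).toNat + (horiz x j).toNat =
      (vert x j.succ).toNat + (horiz (x + 1) j).toNat
  /-- No path enters from below. -/
  bottom : ∀ x, vert x 0 = false
  /-- A path enters each row from the left. -/
  left : ∀ j, horiz 0 j = true
  /-- No path escapes to the right: all paths exit through the top. -/
  right : ∀ j, ∃ X, ∀ x, X ≤ x → horiz x j = false

instance (n : ℕ) : MeasurableSpace (PathConfig n) := ⊤

instance (n : ℕ) : DiscreteMeasurableSpace (PathConfig n) := ⟨fun _ => trivial⟩

/-- The arrow configuration `(i₁, j₁; i₂, j₂)` of a path configuration at a vertex: the arrows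
entering from the bottom and from the left, and leaving to the top and to the right. -/
def PathConfig.at {n : ℕ} (ω : PathConfig n) (v : ℕ × Fin n) : Bool × Bool × Bool × Bool :=
  (ω.vert v.1 v.2.castSucc, ω.horiz v.1 v.2, ω.vert v.1 v.2.succ, ω.horiz (v.1 + 1) v.2)

/-- The six vertex weights; `w 0, …, w 5` are `w₁, …, w₆`. -/
def vertexWeight (w : Fin 6 → ℝ) : Bool × Bool × Bool × Bool → ℝ
  | (false, false, false, false) => w 0
  | (true, true, true, true) => w 1
  | (true, false, true, false) => w 2
  | (false, true, false, true) => w 3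
  | (true, false, false, true) => w 4
  | (false, true, true, false) => w 5
  | _ => 0

/-- `w₁^{N₁} ⋯ w₆^{N₆}`, with `N_r` the number of vertices in `Λ` of the `r`-th type. -/
def weightIn {n : ℕ} (w : Fin 6 → ℝ) (Λ : Finset (ℕ × Fin n)) (ω : PathConfig n) : ℝ :=
  ∏ v ∈ Λ, vertexWeight w (ω.at v)

/-- `P_n^l`: configurations whose paths leave through the top at the positions `l_1, …, l_n`. -/
def pathsWithTop {n : ℕ} (l : Fin n → ℤ) : Set (PathConfig n) :=
  {ω | ∀ x : ℕ, ω.vert x (Fin.last n) = true ↔ ∃ i, l i = (x : ℤ)}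

/-- The configurations in `P` that coincide with `ω₀` at all vertices outside of `Λ`. -/
def agreeOff {n : ℕ} (P : Set (PathConfig n)) (Λ : Finset (ℕ × Fin n)) (ω₀ : PathConfig n) :
    Set (PathConfig n) :=
  {ω | ω ∈ P ∧ ∀ v, v ∉ Λ → ω.at v = ω₀.at v}

/-- The Gibbs property, for the six-vertex model on `D_n` with weights `w`, of a probability measure
`ν` on the set `P` of configurations with given boundary data: for every finite `Λ ⊂ D_n`,
conditionally on the configuration outside of `Λ`, the probability of `ω` is proportional to
`w₁^{N₁} ⋯ w₆^{N₆}`. -/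
def SixVertexModelGibbs {n : ℕ} (w : Fin 6 → ℝ) (P : Set (PathConfig n))
    (ν : Measure (PathConfig n)) : Prop :=
  ∀ (Λ : Finset (ℕ × Fin n)), ∀ ω₀ ∈ P, ν (agreeOff P Λ ω₀) ≠ 0 →
    ∃ c : ℝ, ∀ ω ∈ agreeOff P Λ ω₀,
      (ProbabilityTheory.cond ν (agreeOff P Λ ω₀)).real {ω} = c * weightIn w Λ ω

/-! ### The bijection between half-strict patterns and path configurations -/

/-- The number of entries less than `x` in the row of size `k`. -/
def HalfStrictGT.count {n : ℕ} (m : HalfStrictGT n) (k : ℕ) (hk : k ≤ n) (x : ℤ) : ℕ :=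
  (Finset.univ.filter fun i : Fin k => row m.entry k hk i < x).card

theorem HalfStrictGT.count_le {n : ℕ} (m : HalfStrictGT n) (k : ℕ) (hk : k + 1 ≤ n) (x : ℤ) :
    m.count k (by omega) x ≤ m.count (k + 1) hk x := by
  refine Finset.card_le_card_of_injOn Fin.castSucc ?_ (Fin.castSucc_injective k).injOn
  intro i hi
  simp only [Finset.coe_filter, Finset.mem_univ, true_and, Set.mem_ofPred_eq] at hi ⊢
  exact (m.interlace k hk i).1.trans_lt hi

theorem HalfStrictGT.count_le_succ {n : ℕ} (m : HalfStrictGT n) (k : ℕ) (hk : k + 1 ≤ n)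
    (x : ℤ) : m.count (k + 1) hk x ≤ m.count k (by omega) x + 1 := by
  have h : (Finset.univ.filter fun i : Fin (k + 1) => row m.entry (k + 1) hk i < x) ⊆
      insert 0 ((Finset.univ.filter fun i : Fin k =>
        row m.entry k (by omega) i < x).image Fin.succ) := by
    intro i hi
    simp only [Finset.mem_filter, Finset.mem_univ, true_and] at hi
    rcases Fin.eq_zero_or_eq_succ i with rfl | ⟨j, rfl⟩
    · simp
    · refine Finset.mem_insert_of_mem (Finset.mem_image_of_mem _ ?_)
      simp only [Finset.mem_filter, Finset.mem_univ, true_and]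
      exact (m.interlace k hk j).2.trans_lt hi
  exact (Finset.card_le_card h).trans
    ((Finset.card_insert_le _ _).trans (Nat.add_le_add_right Finset.card_image_le 1))

theorem HalfStrictGT.count_add_one {n : ℕ} (m : HalfStrictGT n) (k : ℕ) (hk : k ≤ n) (x : ℤ) :
    m.count k hk (x + 1) =
      m.count k hk x + (decide (∃ i, row m.entry k hk i = x)).toNat := by
  unfold HalfStrictGT.count
  have hsplit : (Finset.univ.filter fun i : Fin k => row m.entry k hk i < x + 1) =
      (Finset.univ.filter fun i : Fin k => row m.entry k hk i < x) ∪
        (Finset.univ.filter fun i : Fin k => row m.entry k hk i = x) := by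
    ext i
    simp only [Finset.mem_filter, Finset.mem_univ, true_and, Finset.mem_union]
    omega
  rw [hsplit, Finset.card_union_of_disjoint]
  · congr 1
    by_cases h : ∃ i, row m.entry k hk i = x
    · obtain ⟨i, hi⟩ := h
      rw [decide_eq_true ⟨i, hi⟩, Bool.toNat_true, Finset.card_eq_one]
      refine ⟨i, ?_⟩
      ext i'
      simp only [Finset.mem_filter, Finset.mem_univ, true_and, Finset.mem_singleton]
      exact ⟨fun h => (m.strictMono k hk).injective (h.trans hi.symm), fun h => h ▸ hi⟩
    · rw [decide_eq_false h, Bool.toNat_false, Finset.card_eq_zero]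
      exact Finset.filter_eq_empty_iff.2 fun i _ hi => h ⟨i, hi⟩
  · refine Finset.disjoint_filter.2 fun i _ h1 h2 => ?_
    omega

/-- The map `h⁻¹ : GT^{n+} → P_n`: the configuration whose paths cross the horizontal line at
height `k + 1/2` at the positions `m^k_1 < ⋯ < m^k_k`, for `k = 1, …, n`.  Its horizontal edges are
then forced: by conservation, the number of paths on the edge entering `(x, j + 1)` from the left
is `1 + #{i : m^j_i < x} - #{i : m^{j+1}_i < x}`. -/
def HalfStrictGT.toPath {n : ℕ} (m : HalfStrictGT n) : PathConfig n where
  vert x k := decide (∃ i, row m.entry k.val (by omega) i = (x : ℤ))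
  horiz x j := decide (m.count (j.val + 1) (by omega) x = m.count j.val (by omega) x)
  conserve x j := by
    have h1 := m.count_add_one j.val (by omega) x
    have h2 := m.count_add_one (j.val + 1) (by omega) x
    have h3 := m.count_le j.val (by omega) x
    have h4 := m.count_le_succ j.val (by omega) x
    have h5 := m.count_le j.val (by omega) (x + 1)
    have h6 := m.count_le_succ j.val (by omega) (x + 1)
    simp only [Fin.val_castSucc, Fin.val_succ, Nat.cast_add, Nat.cast_one]
    have key : ∀ p q : ℕ, q ≤ p → p ≤ q + 1 → (decide (p = q)).toNat + p = 1 + q := by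
      intro p q hqp hpq
      by_cases h : p = q
      · simp [h]
      · rw [decide_eq_false h, Bool.toNat_false]
        omega
    have h7 := key _ _ h3 h4
    have h8 := key _ _ h5 h6
    omega
  bottom x := by
    simp
  left j := by
    have h (k : ℕ) (hk : k ≤ n) : m.count k hk ((0 : ℕ) : ℤ) = 0 :=
      Finset.card_eq_zero.2 (Finset.filter_eq_empty_iff.2 fun i _ =>
        not_lt.2 (m.row_nonneg k hk i))
    rw [h, h, decide_eq_true rfl]
  right j := by
    have h (k : ℕ) (hk : k ≤ n) : ∃ X : ℕ, ∀ x : ℕ, X ≤ x → m.count k hk x = k := by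
      obtain ⟨B, hB⟩ := Finite.bddAbove_range (row m.entry k hk)
      refine ⟨(B + 1).toNat, fun x hx => ?_⟩
      unfold HalfStrictGT.count
      rw [Finset.filter_true_of_mem, Finset.card_univ, Fintype.card_fin]
      intro i _
      have : row m.entry k hk i ≤ B := hB ⟨i, rfl⟩
      omega
    obtain ⟨X, hX⟩ := h j.val (by omega)
    obtain ⟨Y, hY⟩ := h (j.val + 1) (by omega)
    refine ⟨max X Y, fun x hx => ?_⟩
    rw [hX x (by omega), hY x (by omega)]
    simp

/-! ### The six-vertex Gibbs property of measures on half-strict patterns -/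

/-- The six-vertex Gibbs property of a probability measure `ρ` on `GT^{n+}`: for each `l` such that
`ρ(m^n = l) > 0`, the image under `h⁻¹` of `ρ(· | m^n = l)`, which is a measure on `P_n^l`, has the
Gibbs property for the six-vertex model on `D_n` with weights `w`. -/
def SixVertexGibbs {n : ℕ} (w : Fin 6 → ℝ) (ρ : Measure (HalfStrictGT n)) : Prop :=
  ∀ l : Fin n → ℤ, ρ {m | topRow m.entry = l} ≠ 0 →
    SixVertexModelGibbs w (pathsWithTop l)
      ((ProbabilityTheory.cond ρ {m | topRow m.entry = l}).map HalfStrictGT.toPath)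

/-- The affine map `g(y) = (y - a · 𝟏) / b`, applied to a half-strict pattern. -/
noncomputable def rescale {n : ℕ} (a b : ℝ) (m : HalfStrictGT n) : GTIndex n → ℝ :=
  fun q => ((m.entry q : ℝ) - a) / b

/-- The law of the rescaled pattern, the image `ρ ∘ g⁻¹` of `ρ` under `g(y) = (y - a · 𝟏) / b`. -/
noncomputable def rescaledLaw {n : ℕ} (a b : ℝ) (ρ : ProbabilityMeasure (HalfStrictGT n)) :
    ProbabilityMeasure (GTIndex n → ℝ) :=
  ρ.map (f := rescale a b) Measurable.of_discrete.aemeasurable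

end SixVertexGT

open SixVertexGT

/-! Consider the move that resamples one entry below the top row uniformly between the largest lower
bound and the least upper bound imposed by the other entries. Two facts carry the proof: the limit
`μ` is invariant under each such move (`invariant_of_tendsto`), and a probability measure on the
cone that is invariant under all of them has the continuous Gibbs property
(`continuousGibbs_of_invariant`).

Invariance of the limit. In the product of vertex weights, all factors attached to single edges
depend on the top row only, because it determines the relevant edge counts. What remains depends
only on which neighbouring entries of the pattern coincide (`exists_weightIn_toPath_eq`,
`exists_measureReal_singleton_eq`). With all entries but one fixed, the free entry is therefore
uniform in the interior of an integer interval, and each end has at most a constant times the mass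
of an interior point. After division by `b`, the mean of a Lipschitz function differs from its mean
over the real interval by `O(b^{-1/2})`, uniformly in the length: on a long interval the ends carry
little mass, on a short one the function hardly varies (`abs_sum_mul_sub_integral_le`). Summing over
the fixed entries and letting `b → ∞` gives invariance.

From invariance to Gibbs. The uniform measure on each polytope is invariant too, since Lebesgue
measure is invariant under translations along a free coordinate (`invariant_uniformGT`). Sweeping
through all entries from smaller to larger contracts oscillations: with probability bounded below
every entry lands close to its lower bound, and the starting point is forgotten
(`norm_sweep_sub_sweep_le`). Hence iterated sweeps of `f` converge on a polytope to a constant,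
which must be the uniform mean of `f`; integrating this limit against `μ` is the Gibbs property. -/

namespace SixVertexGT

/-! ### Resampling one coordinate of an order polytope -/

section OrderPolytope

variable {ι : Type*} [Fintype ι]

/-- The cone of the functions that respect the relation `R`. -/
def orderCone {α : Type*} [LE α] (R : ι → ι → Prop) : Set (ι → α) :=
  {y | ∀ p q, R p q → y p ≤ y q}

/-- A coordinate that is bounded below and above by other coordinates. -/
structure Site (R : ι → ι → Prop) [DecidableRel R] where
  idx : ι
  below : (Finset.univ.filter fun p => R p idx).Nonempty
  above : (Finset.univ.filter fun p => R idx p).Nonempty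
  irrefl : ¬ R idx idx

namespace Site

variable {R : ι → ι → Prop} [DecidableRel R] (s : Site R)

/-- The largest lower bound that the other coordinates impose on the coordinate `s`. -/
def lo {α : Type*} [LinearOrder α] (y : ι → α) : α :=
  (Finset.univ.filter fun p => R p s.idx).sup' s.below y

/-- The least upper bound that the other coordinates impose on the coordinate `s`. -/
def hi {α : Type*} [LinearOrder α] (y : ι → α) : α :=
  (Finset.univ.filter fun p => R s.idx p).inf' s.above y

section Order

variable {α : Type*} [LinearOrder α]

theorem lo_le_iff {y : ι → α} {c : α} : s.lo y ≤ c ↔ ∀ p, R p s.idx → y p ≤ c := by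
  simp [lo, Finset.sup'_le_iff]

theorem le_hi_iff {y : ι → α} {c : α} : c ≤ s.hi y ↔ ∀ p, R s.idx p → c ≤ y p := by
  simp [hi, Finset.le_inf'_iff]

theorem le_lo {y : ι → α} {p : ι} (h : R p s.idx) : y p ≤ s.lo y := s.lo_le_iff.1 le_rfl p h

theorem hi_le {y : ι → α} {p : ι} (h : R s.idx p) : s.hi y ≤ y p := s.le_hi_iff.1 le_rfl p h

theorem exists_eq_lo (y : ι → α) : ∃ p, R p s.idx ∧ s.lo y = y p := by
  obtain ⟨p, hp, h⟩ := Finset.exists_mem_eq_sup' s.below y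
  exact ⟨p, (Finset.mem_filter.1 hp).2, h⟩

theorem exists_eq_hi (y : ι → α) : ∃ p, R s.idx p ∧ s.hi y = y p := by
  obtain ⟨p, hp, h⟩ := Finset.exists_mem_eq_inf' s.above y
  exact ⟨p, (Finset.mem_filter.1 hp).2, h⟩

theorem lo_congr {y y' : ι → α} (h : ∀ p, p ≠ s.idx → y p = y' p) : s.lo y = s.lo y' :=
  Finset.sup'_congr _ rfl fun p hp => h p fun e =>
    s.irrefl (by simpa [e] using hp)

theorem hi_congr {y y' : ι → α} (h : ∀ p, p ≠ s.idx → y p = y' p) : s.hi y = s.hi y' :=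
  Finset.inf'_congr _ rfl fun p hp => h p fun e =>
    s.irrefl (by simpa [e] using hp)

theorem lo_le {y : ι → α} (hy : y ∈ orderCone R) : s.lo y ≤ y s.idx :=
  s.lo_le_iff.2 fun p hp => hy p _ hp

theorem le_hi {y : ι → α} (hy : y ∈ orderCone R) : y s.idx ≤ s.hi y :=
  s.le_hi_iff.2 fun p hp => hy _ p hp

/-- Serves to carry the integer bounds of a half-strict pattern over to the rescaled real pattern.
-/
theorem lo_comp {β : Type*} [LinearOrder β] {g : α → β} (hg : Monotone g) (y : ι → α) :
    s.lo (fun p => g (y p)) = g (s.lo y) :=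
  (Finset.apply_sup'_eq_sup'_comp s.below g hg.map_sup).symm

theorem hi_comp {β : Type*} [LinearOrder β] {g : α → β} (hg : Monotone g) (y : ι → α) :
    s.hi (fun p => g (y p)) = g (s.hi y) :=
  (Finset.apply_inf'_eq_inf'_comp s.above g hg.map_inf).symm

end Order

theorem abs_lo_sub_lo_le {y y' : ι → ℝ} {d : ℝ} (h : ∀ p, R p s.idx → |y p - y' p| ≤ d) :
    |s.lo y - s.lo y'| ≤ d := by
  obtain ⟨p, hp, e⟩ := s.exists_eq_lo y
  obtain ⟨p', hp', e'⟩ := s.exists_eq_lo y'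
  have h1 := abs_le.1 (h p hp)
  have h2 := abs_le.1 (h p' hp')
  have h3 := s.le_lo (y := y) hp'
  have h4 := s.le_lo (y := y') hp
  rw [abs_le]
  constructor <;> linarith

theorem abs_hi_sub_hi_le {y y' : ι → ℝ} {d : ℝ} (h : ∀ p, R s.idx p → |y p - y' p| ≤ d) :
    |s.hi y - s.hi y'| ≤ d := by
  obtain ⟨p, hp, e⟩ := s.exists_eq_hi y
  obtain ⟨p', hp', e'⟩ := s.exists_eq_hi y'
  have h1 := abs_le.1 (h p hp)
  have h2 := abs_le.1 (h p' hp')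
  have h3 := s.hi_le (y := y) hp'
  have h4 := s.hi_le (y := y') hp
  rw [abs_le]
  constructor <;> linarith

theorem continuous_lo : Continuous fun y : ι → ℝ => s.lo y :=
  Continuous.finset_sup'_apply _ fun p _ => continuous_apply p

theorem continuous_hi : Continuous fun y : ι → ℝ => s.hi y :=
  Continuous.finset_inf'_apply _ fun p _ => continuous_apply p

variable [DecidableEq ι]

theorem lo_update {α : Type*} [LinearOrder α] (y : ι → α) (c : α) :
    s.lo (Function.update y s.idx c) = s.lo y :=
  s.lo_congr fun _ hp => Function.update_of_ne hp _ _

theorem hi_update {α : Type*} [LinearOrder α] (y : ι → α) (c : α) :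
    s.hi (Function.update y s.idx c) = s.hi y :=
  s.hi_congr fun _ hp => Function.update_of_ne hp _ _

theorem update_mem_orderCone {α : Type*} [LinearOrder α] {y : ι → α} (hy : y ∈ orderCone R)
    {c : α} (h1 : s.lo y ≤ c) (h2 : c ≤ s.hi y) : Function.update y s.idx c ∈ orderCone R := by
  intro p q hpq
  by_cases hp : p = s.idx
  · subst hp
    have hq : q ≠ s.idx := fun e => s.irrefl (e ▸ hpq)
    rw [Function.update_self, Function.update_of_ne hq]
    exact s.le_hi_iff.1 h2 q hpq
  · rw [Function.update_of_ne hp]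
    by_cases hq : q = s.idx
    · subst hq
      rw [Function.update_self]
      exact s.lo_le_iff.1 h1 p hpq
    · rw [Function.update_of_ne hq]
      exact hy p q hpq

/-- Replace the coordinate `s` by the point that divides its allowed range in the ratio
`t : 1 - t`. -/
noncomputable def resample (y : ι → ℝ) (t : ℝ) : ι → ℝ :=
  Function.update y s.idx (s.lo y + t * (s.hi y - s.lo y))

theorem continuous_resample : Continuous fun z : (ι → ℝ) × ℝ => s.resample z.1 z.2 :=
  continuous_fst.update s.idx (((s.continuous_lo.comp continuous_fst)).add
    (continuous_snd.mul ((s.continuous_hi.comp continuous_fst).sub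
      (s.continuous_lo.comp continuous_fst))))

theorem resample_self (y : ι → ℝ) (t : ℝ) :
    s.resample y t s.idx = s.lo y + t * (s.hi y - s.lo y) := Function.update_self ..

theorem resample_of_ne (y : ι → ℝ) (t : ℝ) {p : ι} (hp : p ≠ s.idx) :
    s.resample y t p = y p := Function.update_of_ne hp ..

/-- The new coordinate is the convex combination of `lo` and `hi` with weights `1 - t` and `t`, and
both bounds are 1-Lipschitz in the sup norm. Two configurations resampled with the same `t` thus
never move apart in this norm. -/
theorem abs_resample_sub_le {y y' : ι → ℝ} {d t : ℝ} (h0 : 0 ≤ t) (h1 : t ≤ 1)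
    (h : ∀ p, |y p - y' p| ≤ d) (p : ι) : |s.resample y t p - s.resample y' t p| ≤ d := by
  by_cases hp : p = s.idx
  · subst hp
    rw [resample_self, resample_self]
    have h2 := abs_le.1 (s.abs_lo_sub_lo_le (d := d) fun p _ => h p)
    have h3 := abs_le.1 (s.abs_hi_sub_hi_le (d := d) fun p _ => h p)
    rw [abs_le]
    constructor <;> nlinarith
  · rw [s.resample_of_ne _ _ hp, s.resample_of_ne _ _ hp]
    exact h p

/-- The average of a function over the allowed range of the coordinate `s`. -/
noncomputable def average {F : Type*} [NormedAddCommGroup F] [NormedSpace ℝ F]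
    (f : (ι → ℝ) → F) (y : ι → ℝ) : F :=
  ∫ t in (0 : ℝ)..1, f (s.resample y t)

section Average

variable {F : Type*} [NormedAddCommGroup F] [NormedSpace ℝ F] {f : (ι → ℝ) → F}

theorem continuous_resample_right (y : ι → ℝ) : Continuous fun t => s.resample y t :=
  s.continuous_resample.comp (Continuous.prodMk_right y)

theorem continuous_average (hf : Continuous f) : Continuous (s.average f) :=
  intervalIntegral.continuous_parametric_intervalIntegral_of_continuous'
    (f := fun y t => f (s.resample y t)) (hf.comp s.continuous_resample) 0 1

theorem norm_average_le {B : ℝ} (hB : ∀ y, ‖f y‖ ≤ B) (y : ι → ℝ) : ‖s.average f y‖ ≤ B := by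
  have := intervalIntegral.norm_integral_le_of_norm_le_const (a := (0 : ℝ)) (b := 1) (C := B)
    (f := fun t => f (s.resample y t)) fun t _ => hB _
  simpa [average] using this

theorem average_sub_average (hf : Continuous f) (y y' : ι → ℝ) :
    s.average f y - s.average f y' =
      ∫ t in (0 : ℝ)..1, (f (s.resample y t) - f (s.resample y' t)) :=
  (intervalIntegral.integral_sub
    ((hf.comp (s.continuous_resample_right y)).intervalIntegrable _ _)
    ((hf.comp (s.continuous_resample_right y')).intervalIntegrable _ _)).symm

theorem norm_average_sub_average_le (hf : Continuous f) {y y' : ι → ℝ} {β : ℝ}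
    (h : ∀ t, 0 ≤ t → t ≤ 1 → ‖f (s.resample y t) - f (s.resample y' t)‖ ≤ β) :
    ‖s.average f y - s.average f y'‖ ≤ β := by
  rw [s.average_sub_average hf]
  refine (intervalIntegral.norm_integral_le_of_norm_le_const (C := β) fun t ht => ?_).trans
    (by simp)
  rw [Set.uIoc_of_le zero_le_one] at ht
  exact h t ht.1.le ht.2

/-- With probability `ε` the draw satisfies `t ≤ ε`, where a better bound is available; this is the
source of the contraction. -/
theorem norm_average_sub_average_le_of_split (hf : Continuous f) {y y' : ι → ℝ} {ε α β : ℝ}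
    (hε0 : 0 ≤ ε) (hε1 : ε ≤ 1)
    (h1 : ∀ t, 0 ≤ t → t ≤ ε → ‖f (s.resample y t) - f (s.resample y' t)‖ ≤ α)
    (h2 : ∀ t, 0 ≤ t → t ≤ 1 → ‖f (s.resample y t) - f (s.resample y' t)‖ ≤ β) :
    ‖s.average f y - s.average f y'‖ ≤ ε * α + (1 - ε) * β := by
  have hc : Continuous fun t => f (s.resample y t) - f (s.resample y' t) :=
    (hf.comp (s.continuous_resample_right y)).sub (hf.comp (s.continuous_resample_right y'))
  rw [s.average_sub_average hf, ← intervalIntegral.integral_add_adjacent_intervals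
    (hc.intervalIntegrable 0 ε) (hc.intervalIntegrable ε 1)]
  refine (norm_add_le _ _).trans (add_le_add ?_ ?_)
  · refine (intervalIntegral.norm_integral_le_of_norm_le_const (C := α) fun t ht => ?_).trans
      (by rw [sub_zero, abs_of_nonneg hε0, mul_comm])
    rw [Set.uIoc_of_le hε0] at ht
    exact h1 t ht.1.le ht.2
  · refine (intervalIntegral.norm_integral_le_of_norm_le_const (C := β) fun t ht => ?_).trans
      (by rw [abs_of_nonneg (sub_nonneg.2 hε1), mul_comm])
    rw [Set.uIoc_of_le hε1] at ht
    exact h2 t (hε0.trans ht.1.le) ht.2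

end Average

/-- The measure `ν` is invariant under resampling the coordinate `s` uniformly. -/
def Invariant (ν : Measure (ι → ℝ)) : Prop :=
  (ν.prod (volume.restrict (Set.Ioc (0 : ℝ) 1))).map (fun z => s.resample z.1 z.2) = ν

theorem integral_resample {F : Type*} [NormedAddCommGroup F] [NormedSpace ℝ F]
    {f : (ι → ℝ) → F} (hf : Continuous f) {B : ℝ} (hB : ∀ y, ‖f y‖ ≤ B)
    [SecondCountableTopology F]
    (ν : Measure (ι → ℝ)) [IsFiniteMeasure ν] :
    ∫ y, f y ∂((ν.prod (volume.restrict (Set.Ioc (0 : ℝ) 1))).map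
      (fun z => s.resample z.1 z.2)) = ∫ y, s.average f y ∂ν := by
  rw [integral_map s.continuous_resample.measurable.aemeasurable
    hf.aestronglyMeasurable, integral_prod]
  · simp only [average, intervalIntegral.integral_of_le zero_le_one]
  · exact Integrable.of_bound
      (hf.comp s.continuous_resample).aestronglyMeasurable B
      (Eventually.of_forall fun z => hB _)

theorem Invariant.integral_average {F : Type*} [NormedAddCommGroup F] [NormedSpace ℝ F]
    [SecondCountableTopology F] {s : Site R}
    {f : (ι → ℝ) → F} (hf : Continuous f) {B : ℝ} (hB : ∀ y, ‖f y‖ ≤ B)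
    {ν : Measure (ι → ℝ)} [IsFiniteMeasure ν] (h : s.Invariant ν) :
    ∫ y, s.average f y ∂ν = ∫ y, f y ∂ν := by
  rw [← s.integral_resample hf hB, h]

end Site

/-! ### Sweeps of the resampling dynamics -/

section Sweep

variable [DecidableEq ι] {R : ι → ι → Prop} [DecidableRel R]
  {F : Type*} [NormedAddCommGroup F] [NormedSpace ℝ F]

/-- The expectation of `f` after the coordinates of the list have been resampled, in this order. -/
noncomputable def sweep : List (Site R) → ((ι → ℝ) → F) → (ι → ℝ) → F
  | [], f => f
  | s :: l, f => s.average (sweep l f)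

theorem continuous_sweep (l : List (Site R)) {f : (ι → ℝ) → F} (hf : Continuous f) :
    Continuous (sweep l f) := by
  induction l with
  | nil => exact hf
  | cons s l ih => exact s.continuous_average ih

theorem norm_sweep_le (l : List (Site R)) {f : (ι → ℝ) → F} {B : ℝ} (hB : ∀ y, ‖f y‖ ≤ B) :
    ∀ y, ‖sweep l f y‖ ≤ B := by
  induction l with
  | nil => exact hB
  | cons s l ih => exact s.norm_average_le ih

theorem integral_sweep [SecondCountableTopology F] {l : List (Site R)} {ν : Measure (ι → ℝ)}
    [IsFiniteMeasure ν] (hν : ∀ s ∈ l, s.Invariant ν) {f : (ι → ℝ) → F} (hf : Continuous f)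
    {B : ℝ} (hB : ∀ y, ‖f y‖ ≤ B) : ∫ y, sweep l f y ∂ν = ∫ y, f y ∂ν := by
  induction l with
  | nil => rfl
  | cons s l ih =>
    rw [← ih fun s' h => hν s' (List.mem_cons_of_mem _ h)]
    exact (hν s List.mem_cons_self).integral_average (continuous_sweep l hf) (norm_sweep_le l hB)

/-- On `C`, the function `f` oscillates by at most `β`, and by at most `η` at distance `δ`. -/
structure OscLE (C : Set (ι → ℝ)) (δ η β : ℝ) (f : (ι → ℝ) → F) : Prop where
  close : ∀ y ∈ C, ∀ y' ∈ C, (∀ p, |y p - y' p| ≤ δ) → ‖f y - f y'‖ ≤ η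
  all : ∀ y ∈ C, ∀ y' ∈ C, ‖f y - f y'‖ ≤ β

variable {C : Set (ι → ℝ)} {l : List (Site R)}

/-- Driving both starting points by the same `t` keeps them in `C` and does not increase their
distance, so neither modulus deteriorates. -/
theorem OscLE.sweep
    (hC : ∀ s ∈ l, ∀ y ∈ C, ∀ t, 0 ≤ t → t ≤ 1 → s.resample y t ∈ C)
    {δ η β : ℝ} {f : (ι → ℝ) → F} (hf : Continuous f) (h : OscLE C δ η β f) :
    OscLE C δ η β (sweep l f) := by
  induction l with
  | nil => exact h
  | cons s l ih =>
    have ih := ih fun s' h => hC s' (List.mem_cons_of_mem _ h)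
    have hs := hC s List.mem_cons_self
    constructor
    · intro y hy y' hy' hd
      exact s.norm_average_sub_average_le (continuous_sweep l hf) fun t h0 h1 =>
        ih.close _ (hs y hy t h0 h1) _ (hs y' hy' t h0 h1) (s.abs_resample_sub_le h0 h1 hd)
    · intro y hy y' hy'
      exact s.norm_average_sub_average_le (continuous_sweep l hf) fun t h0 h1 =>
        ih.all _ (hs y hy t h0 h1) _ (hs y' hy' t h0 h1)

/-- A Doeblin argument. If `t ≤ ε` at a site, its new value is within `ε * D` of its lower bound.
The order of the list ensures that this bound only involves coordinates that are never resampled or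
already have been, and those are within `d` of each other for the two starting points. If all draws
are at most `ε`, the final configurations are within `δ`, and `η` applies; otherwise `β` does. -/
theorem norm_sweep_sub_sweep_le
    (hC : ∀ s ∈ l, ∀ y ∈ C, ∀ t, 0 ≤ t → t ≤ 1 → s.resample y t ∈ C)
    {D : ℝ} (hD : ∀ s ∈ l, ∀ y ∈ C, 0 ≤ s.hi y - s.lo y ∧
      s.hi y - s.lo y ≤ D)
    (hl : l.Pairwise fun s s' => ¬ R s'.idx s.idx) {δ η β ε : ℝ} (hε0 : 0 ≤ ε) (hε1 : ε ≤ 1)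
    {f : (ι → ℝ) → F} (hf : Continuous f) (h : OscLE C δ η β f) {d : ℝ}
    (hd : d + l.length * (ε * D) ≤ δ)
    (y : ι → ℝ) (hy : y ∈ C) (y' : ι → ℝ) (hy' : y' ∈ C)
    (hyy' : ∀ p, (∀ s ∈ l, p ≠ s.idx) → |y p - y' p| ≤ d) :
    ‖SixVertexGT.sweep l f y - SixVertexGT.sweep l f y'‖ ≤
      ε ^ l.length * η + (1 - ε ^ l.length) * β := by
  induction l generalizing d y y' with
  | nil =>
    simp only [List.length_nil, pow_zero, Nat.cast_zero, zero_mul, add_zero] at hd ⊢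
    simpa [SixVertexGT.sweep] using h.close y hy y' hy' fun p => (hyy' p (by simp)).trans hd
  | cons s l ih =>
    have hC' := fun s' h => hC s' (List.mem_cons_of_mem _ h)
    have hs := hC s List.mem_cons_self
    have hosc := OscLE.sweep hC' hf h
    obtain ⟨hl1, hl2⟩ := List.pairwise_cons.1 hl
    have hDy := hD s List.mem_cons_self y hy
    have hDy' := hD s List.mem_cons_self y' hy'
    have key := s.norm_average_sub_average_le_of_split (continuous_sweep l hf) (y := y) (y' := y')
      (α := ε ^ l.length * η + (1 - ε ^ l.length) * β) (β := β) hε0 hε1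
      (fun t h0 h1 => ?_)
      (fun t h0 h1 => hosc.all _ (hs y hy t h0 h1) _ (hs y' hy' t h0 h1))
    · refine key.trans (le_of_eq ?_)
      simp only [List.length_cons, pow_succ]
      ring
    · refine ih hC' (fun s' h => hD s' (List.mem_cons_of_mem _ h)) hl2 (d := d + ε * D) ?_
        _ (hs y hy t h0 (h1.trans hε1)) _ (hs y' hy' t h0 (h1.trans hε1)) fun p hp => ?_
      · simp only [List.length_cons, Nat.cast_succ] at hd
        linarith
      · have hεD : 0 ≤ ε * D := mul_nonneg hε0 (hDy.1.trans hDy.2)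
        by_cases hps : p = s.idx
        · subst hps
          rw [s.resample_self, s.resample_self]
          -- No coordinate below `s` is still waiting in the list, so `hyy'` covers everything that
          -- `lo` depends on.
          have h3 : |s.lo y - s.lo y'| ≤ d := s.abs_lo_sub_lo_le fun p hp => hyy' p fun s' hs' e => by
            rcases List.mem_cons.1 hs' with rfl | hs'
            · exact s'.irrefl (e ▸ hp)
            · exact hl1 s' hs' (e ▸ hp)
          have h4 : 0 ≤ t * (s.hi y - s.lo y) := mul_nonneg h0 hDy.1
          have h5 : t * (s.hi y - s.lo y) ≤ ε * D := mul_le_mul h1 hDy.2 hDy.1 hε0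
          have h6 : 0 ≤ t * (s.hi y' - s.lo y') := mul_nonneg h0 hDy'.1
          have h7 : t * (s.hi y' - s.lo y') ≤ ε * D := mul_le_mul h1 hDy'.2 hDy'.1 hε0
          rw [abs_le] at h3 ⊢
          constructor <;> linarith
        · rw [s.resample_of_ne _ _ hps, s.resample_of_ne _ _ hps]
          refine (hyy' p fun s' hs' => ?_).trans (by linarith)
          rcases List.mem_cons.1 hs' with rfl | hs'
          · exact hps
          · exact hp s' hs'

/-- Iterated sweeps make a continuous function asymptotically constant on a compact set all of
whose points agree in the coordinates that are not resampled. -/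
theorem exists_iterate_sweep_osc_le
    (hC : ∀ s ∈ l, ∀ y ∈ C, ∀ t, 0 ≤ t → t ≤ 1 → s.resample y t ∈ C)
    (hCc : IsCompact C) {D : ℝ}
    (hD : ∀ s ∈ l, ∀ y ∈ C, 0 ≤ s.hi y - s.lo y ∧ s.hi y - s.lo y ≤ D)
    (hl : l.Pairwise fun s s' => ¬ R s'.idx s.idx)
    (hfix : ∀ y ∈ C, ∀ y' ∈ C, ∀ p, (∀ s ∈ l, p ≠ s.idx) → y p = y' p)
    {f : (ι → ℝ) → F} (hf : Continuous f) {B : ℝ} (hB : ∀ y, ‖f y‖ ≤ B) {η : ℝ} (hη : 0 < η) :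
    ∃ M : ℕ, ∀ m, M ≤ m → ∀ y ∈ C, ∀ y' ∈ C,
      ‖(SixVertexGT.sweep l)^[m] f y - (SixVertexGT.sweep l)^[m] f y'‖ ≤ η := by
  obtain ⟨δ, hδ, hclose⟩ := Metric.uniformContinuousOn_iff.1
    (hCc.uniformContinuousOn_of_continuous hf.continuousOn) (η / 2) (by linarith)
  -- Uniform continuity needs a strict inequality of distances, hence `δ / 2`; the other half of `η`
  -- is left for the geometrically decaying term.
  have hosc : OscLE C (δ / 2) (η / 2) (2 * B) f := by
    constructor
    · intro y hy y' hy' h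
      rw [← dist_eq_norm]
      refine (hclose y hy y' hy' ?_).le
      refine lt_of_le_of_lt ((dist_pi_le_iff (by linarith)).2 fun p => ?_) (half_lt_self hδ)
      exact h p
    · intro y _ y' _
      refine (norm_sub_le _ _).trans ?_
      linarith [hB y, hB y']
  obtain ⟨ε, hε0, hε1, hε⟩ : ∃ ε : ℝ, 0 < ε ∧ ε ≤ 1 ∧ l.length * (ε * D) ≤ δ / 2 := by
    have hK : 0 < l.length * |D| + 1 := by positivity
    refine ⟨min 1 (δ / 2 / (l.length * |D| + 1)), by positivity, min_le_left _ _, ?_⟩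
    set e := min 1 (δ / 2 / (l.length * |D| + 1)) with he
    have he0 : 0 < e := by positivity
    have h1 : e * (l.length * |D| + 1) ≤ δ / 2 := by
      rw [← le_div_iff₀ hK]
      exact min_le_right _ _
    have h2 : (l.length : ℝ) * (e * D) ≤ l.length * (e * |D|) := by
      gcongr
      exact le_abs_self D
    nlinarith
  set p := ε ^ l.length with hp
  have hp0 : 0 < p := pow_pos hε0 _
  have hp1 : p ≤ 1 := pow_le_one₀ hε0.le hε1
  -- The moduli `δ / 2` and `η / 2` survive every sweep, so the total oscillation obeys `β ↦ p * (η
  -- / 2) + (1 - p) * β`, whose fixed point is `η / 2`.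
  have hiter (m : ℕ) : Continuous ((SixVertexGT.sweep l)^[m] f) ∧
      OscLE C (δ / 2) (η / 2) (η / 2 + (1 - p) ^ m * (2 * B)) ((SixVertexGT.sweep l)^[m] f) := by
    induction m with
    | zero =>
      refine ⟨hf, hosc.close, fun y hy y' hy' => (hosc.all y hy y' hy').trans ?_⟩
      rw [pow_zero]
      linarith
    | succ m ih =>
      rw [Function.iterate_succ_apply']
      refine ⟨continuous_sweep l ih.1, (OscLE.sweep hC ih.1 ih.2).close, fun y hy y' hy' => ?_⟩
      refine (norm_sweep_sub_sweep_le hC hD hl hε0.le hε1 ih.1 ih.2 (d := 0) (by linarith)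
        y hy y' hy' fun p hp => ?_).trans (le_of_eq ?_)
      · rw [hfix y hy y' hy' p hp, sub_self, abs_zero]
      · rw [← hp, pow_succ]
        ring
  have htend : Tendsto (fun m : ℕ => (1 - p) ^ m * (2 * B)) atTop (𝓝 0) := by
    simpa using (tendsto_pow_atTop_nhds_zero_of_lt_one (r := 1 - p) (by linarith)
      (by linarith)).mul_const (2 * B)
  obtain ⟨M, hM⟩ := eventually_atTop.1 (htend.eventually (gt_mem_nhds (half_pos hη)))
  refine ⟨M, fun m hm y hy y' hy' => ((hiter m).2.all y hy y' hy').trans ?_⟩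
  have := hM m hm
  linarith

end Sweep

end OrderPolytope

/-! ### Invariance of uniform measures under resampling -/

namespace Site

open scoped ENNReal

variable {ι : Type*} [Fintype ι] [DecidableEq ι] {R : ι → ι → Prop} [DecidableRel R] (s : Site R)

theorem add_single_eq_update (y : ι → ℝ) (r : ℝ) :
    y + Pi.single s.idx r = Function.update y s.idx (y s.idx + r) := by
  ext p
  by_cases hp : p = s.idx
  · subst hp
    simp
  · simp [hp]

/-- Substituting for `t` the displacement `r` of the coordinate writes the move as a mixture of
translations, to which translation invariance of a measure can be applied. -/
theorem lintegral_resample_eq {g : (ι → ℝ) → ℝ≥0∞} (hg : Measurable g) (y : ι → ℝ)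
    (h : s.lo y < s.hi y) :
    ∫⁻ t in Set.Ioc (0 : ℝ) 1, g (s.resample y t) =
      ∫⁻ r : ℝ, ENNReal.ofReal (s.hi y - s.lo y)⁻¹ *
        (Set.Icc (s.lo y) (s.hi y)).indicator (fun c => g (Function.update y s.idx c))
          (y s.idx + r) := by
  have hl : 0 < s.hi y - s.lo y := sub_pos.2 h
  set φ : ℝ → ℝ≥0∞ := (Set.Icc (s.lo y) (s.hi y)).indicator
    (fun c => g (Function.update y s.idx c)) with hφ
  have hφm : Measurable φ :=
    (hg.comp (continuous_const.update s.idx continuous_id).measurable).indicator measurableSet_Icc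
  have hm' : Measurable fun r => φ (y s.idx + r) := hφm.comp (measurable_const_add _)
  rw [lintegral_const_mul _ hm',
    lintegral_add_left_eq_self φ (y s.idx), ← lintegral_add_left_eq_self φ (s.lo y)]
  have hm : Measurable fun r => φ (s.lo y + r) := hφm.comp (measurable_const_add _)
  conv_rhs => rw [← Real.smul_map_volume_mul_left hl.ne']
  rw [lintegral_smul_measure, lintegral_map hm (measurable_const_mul _), smul_eq_mul, ← mul_assoc,
    ← ENNReal.ofReal_mul (inv_nonneg.2 hl.le), abs_of_pos hl, inv_mul_cancel₀ hl.ne',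
    ENNReal.ofReal_one, one_mul, restrict_Ioc_eq_restrict_Icc,
    ← lintegral_indicator measurableSet_Icc]
  refine lintegral_congr fun t => ?_
  have hiff : s.lo y + (s.hi y - s.lo y) * t ∈ Set.Icc (s.lo y) (s.hi y) ↔
      t ∈ Set.Icc (0 : ℝ) 1 := by
    simp only [Set.mem_Icc]
    constructor
    · rintro ⟨h1, h2⟩
      constructor <;> nlinarith
    · rintro ⟨h1, h2⟩
      constructor <;> nlinarith
  by_cases ht : t ∈ Set.Icc (0 : ℝ) 1
  · rw [Set.indicator_of_mem ht, hφ, Set.indicator_of_mem (hiff.2 ht), resample, mul_comm t]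
  · rw [Set.indicator_of_notMem ht, hφ, Set.indicator_of_notMem (mt hiff.1 ht)]

/-- Where `lo = hi` the move does nothing. Elsewhere its kernel has density `1 / (hi - lo)` along
the coordinate, which is symmetric because the bounds do not depend on that coordinate; symmetry and
translation invariance give reversibility. Translation invariance is asked for only if the
coordinate is somewhere free, since otherwise the coordinate direction may leave the affine span. -/
theorem invariant_restrict (ν : Measure (ι → ℝ)) [SFinite ν] {C : Set (ι → ℝ)}
    (hCm : MeasurableSet C) (hC : C ⊆ orderCone R)
    (hup : ∀ y ∈ C, ∀ c, s.lo y ≤ c → c ≤ s.hi y → Function.update y s.idx c ∈ C)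
    (htrans : (∃ y ∈ C, s.lo y < s.hi y) → ∀ r, ν.map (· + Pi.single s.idx r) = ν) :
    s.Invariant (ν.restrict C) := by
  have hlo := s.continuous_lo.measurable
  have hhi := s.continuous_hi.measurable
  set C' := C ∩ {y | s.lo y < s.hi y} with hC'
  have hSm : MeasurableSet {y : ι → ℝ | s.lo y < s.hi y} := measurableSet_lt hlo hhi
  have hC'm : MeasurableSet C' := hCm.inter hSm
  have hshift (y : ι → ℝ) (hy : y ∈ C') (r : ℝ) :
      y + Pi.single s.idx r ∈ C' ↔ y s.idx + r ∈ Set.Icc (s.lo y) (s.hi y) := by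
    rw [add_single_eq_update]
    constructor
    · intro h
      have h1 := s.lo_le (hC h.1)
      have h2 := s.le_hi (hC h.1)
      rw [lo_update, Function.update_self] at h1
      rw [hi_update, Function.update_self] at h2
      exact ⟨h1, h2⟩
    · intro h
      refine ⟨hup y hy.1 _ h.1 h.2, ?_⟩
      simp only [Set.mem_ofPred_eq, lo_update, hi_update]
      exact hy.2
  refine Measure.ext_of_lintegral _ fun g hg => ?_
  have hgm : Measurable fun z : (ι → ℝ) × ℝ => g (s.resample z.1 z.2) :=
    hg.comp s.continuous_resample.measurable
  rw [lintegral_map hg s.continuous_resample.measurable, lintegral_prod _ hgm.aemeasurable,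
    ← lintegral_inter_add_sdiff _ C hSm, ← lintegral_inter_add_sdiff (fun y => g y) C hSm]
  congr 1
  · rcases Set.eq_empty_or_nonempty C' with he | ⟨y₀, hy₀⟩
    · rw [← hC', he]
      simp
    have htr := htrans ⟨y₀, hy₀.1, hy₀.2⟩
    set k : (ι → ℝ) → ℝ≥0∞ := fun y => ENNReal.ofReal (s.hi y - s.lo y)⁻¹ with hk
    have hkm : Measurable k := (hhi.sub hlo).inv.ennreal_ofReal
    set G := C'.indicator g with hG
    have hGm : Measurable G := hg.indicator hC'm
    have haddm : Measurable fun z : (ι → ℝ) × ℝ => z.1 + Pi.single s.idx z.2 :=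
      measurable_fst.add ((continuous_single s.idx).measurable.comp measurable_snd)
    have hsubm : Measurable fun z : (ι → ℝ) × ℝ => z.1 + Pi.single s.idx (-z.2) :=
      measurable_fst.add ((continuous_single s.idx).measurable.comp measurable_snd.neg)
    have hkshift (y : ι → ℝ) (r : ℝ) : k (y + Pi.single s.idx r) = k y := by
      simp only [hk, add_single_eq_update, lo_update, hi_update]
    calc ∫⁻ y in C', (∫⁻ t in Set.Ioc (0 : ℝ) 1, g (s.resample y t)) ∂ν
        = ∫⁻ y in C', (∫⁻ r : ℝ, k y * G (y + Pi.single s.idx r)) ∂ν := by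
          refine setLIntegral_congr_fun hC'm fun y hy => ?_
          rw [s.lintegral_resample_eq hg y hy.2]
          refine lintegral_congr fun r => ?_
          congr 1
          by_cases hr : y s.idx + r ∈ Set.Icc (s.lo y) (s.hi y)
          · rw [Set.indicator_of_mem hr, hG, Set.indicator_of_mem ((hshift y hy r).2 hr),
              add_single_eq_update]
          · rw [Set.indicator_of_notMem hr, hG,
              Set.indicator_of_notMem (mt (hshift y hy r).1 hr)]
      _ = ∫⁻ y, (∫⁻ r : ℝ, C'.indicator k y * G (y + Pi.single s.idx r)) ∂ν := by
          rw [← lintegral_indicator hC'm]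
          refine lintegral_congr fun y => ?_
          by_cases hy : y ∈ C' <;> simp [hy]
      _ = ∫⁻ r : ℝ, ∫⁻ y, C'.indicator k y * G (y + Pi.single s.idx r) ∂ν :=
          lintegral_lintegral_swap
            (((hkm.indicator hC'm).comp measurable_fst).mul (hGm.comp haddm)).aemeasurable
      _ = ∫⁻ r : ℝ, ∫⁻ y, C'.indicator 1 (y + Pi.single s.idx (-r)) * (k y * G y) ∂ν := by
          refine lintegral_congr fun r => ?_
          have hm1 : Measurable fun y : ι → ℝ => y + Pi.single s.idx r := measurable_add_const _
          have hm2 : Measurable fun y : ι → ℝ => y + Pi.single s.idx (-r) :=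
            measurable_add_const _
          conv_lhs => rw [← htr (-r)]
          have hm3 : Measurable fun y => C'.indicator k y * G (y + Pi.single s.idx r) :=
            (hkm.indicator hC'm).mul (hGm.comp hm1)
          rw [lintegral_map hm3 hm2]
          refine lintegral_congr fun y => ?_
          have e : y + Pi.single s.idx (-r) + Pi.single s.idx r = y := by
            rw [add_assoc, ← Pi.single_add, neg_add_cancel, Pi.single_zero, add_zero]
          rw [e, ← mul_assoc]
          congr 1
          by_cases hy : y + Pi.single s.idx (-r) ∈ C'
          · simp only [Set.indicator_of_mem hy, Pi.one_apply, one_mul, hkshift]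
          · simp only [Set.indicator_of_notMem hy, zero_mul]
      _ = ∫⁻ y, (∫⁻ r : ℝ, C'.indicator 1 (y + Pi.single s.idx (-r)) * (k y * G y)) ∂ν := by
          refine (lintegral_lintegral_swap (Measurable.aemeasurable ?_)).symm
          exact ((measurable_one.indicator hC'm).comp hsubm).mul
            ((hkm.mul hGm).comp measurable_fst)
      -- The admissible displacements back into `C'` form an interval of length `hi - lo`, which
      -- cancels the density `k`.
      _ = ∫⁻ y, G y ∂ν := by
          refine lintegral_congr fun y => ?_
          by_cases hy : y ∈ C'
          · have hpos : 0 < s.hi y - s.lo y := sub_pos.2 hy.2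
            have h1 : ∀ r : ℝ, C'.indicator (1 : (ι → ℝ) → ℝ≥0∞) (y + Pi.single s.idx (-r)) =
                (Set.Icc (y s.idx - s.hi y) (y s.idx - s.lo y)).indicator 1 r := by
              intro r
              have h2 : y + Pi.single s.idx (-r) ∈ C' ↔
                  r ∈ Set.Icc (y s.idx - s.hi y) (y s.idx - s.lo y) := by
                rw [hshift y hy, Set.mem_Icc, Set.mem_Icc]
                constructor <;> rintro ⟨h3, h4⟩ <;> constructor <;> linarith
              by_cases h3 : r ∈ Set.Icc (y s.idx - s.hi y) (y s.idx - s.lo y)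
              · simp only [Set.indicator_of_mem h3, Set.indicator_of_mem (h2.2 h3), Pi.one_apply]
              · simp only [Set.indicator_of_notMem h3, Set.indicator_of_notMem (mt h2.1 h3)]
            simp only [h1]
            rw [lintegral_mul_const _ (measurable_one.indicator measurableSet_Icc),
              lintegral_indicator_one measurableSet_Icc, Real.volume_Icc, ← mul_assoc,
              ← ENNReal.ofReal_mul (by linarith),
              show y s.idx - s.lo y - (y s.idx - s.hi y) = s.hi y - s.lo y by ring,
              mul_inv_cancel₀ hpos.ne', ENNReal.ofReal_one, one_mul]
          · simp [hG, hy]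
      _ = ∫⁻ y in C', g y ∂ν := lintegral_indicator hC'm _
  · refine setLIntegral_congr_fun (hCm.diff hSm) fun y hy => ?_
    have h1 := s.lo_le (hC hy.1)
    have h2 := s.le_hi (hC hy.1)
    have h3 : s.hi y ≤ s.lo y := not_lt.1 hy.2
    have h4 (t : ℝ) : s.resample y t = y := by
      rw [resample, le_antisymm h3 (h1.trans h2), sub_self, mul_zero, add_zero,
        le_antisymm h1 (h2.trans h3), Function.update_eq_self]
    simp [h4]

theorem invariant_cond (ν : Measure (ι → ℝ)) [SFinite ν] {C : Set (ι → ℝ)}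
    (hCm : MeasurableSet C) (hC : C ⊆ orderCone R)
    (hup : ∀ y ∈ C, ∀ c, s.lo y ≤ c → c ≤ s.hi y → Function.update y s.idx c ∈ C)
    (htrans : (∃ y ∈ C, s.lo y < s.hi y) → ∀ r, ν.map (· + Pi.single s.idx r) = ν) :
    s.Invariant (ν[|C]) := by
  have h := s.invariant_restrict ν hCm hC hup htrans
  unfold Invariant at h ⊢
  rw [ProbabilityTheory.cond, Measure.prod_smul_left, Measure.map_smul, h]

end Site

/-! ### The uniform measure on a convex set -/

section UniformOnConvex

variable {E : Type*} [NormedAddCommGroup E] [NormedSpace ℝ E] [MeasurableSpace E] [BorelSpace E]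

theorem measurable_const_add_coe (V : Submodule ℝ E) (p : E) :
    Measurable fun v : V => p + (v : E) :=
  measurable_subtype_coe.const_add p

variable [FiniteDimensional ℝ E]

/-- Lebesgue measure on the affine subspace `p + V`. -/
noncomputable def affineHaar (V : Submodule ℝ E) (p : E) : Measure E :=
  Measure.map (fun v : V => p + (v : E)) Measure.addHaar

instance (V : Submodule ℝ E) (p : E) : SFinite (affineHaar V p) := by
  unfold affineHaar
  infer_instance

theorem map_add_affineHaar {V : Submodule ℝ E} (p : E) {e : E} (he : e ∈ V) :
    (affineHaar V p).map (· + e) = affineHaar V p := by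
  have h1 : Measurable fun x : E => x + e := measurable_add_const e
  rw [affineHaar, Measure.map_map h1 (measurable_const_add_coe V p)]
  have h2 : (fun x : E => x + e) ∘ (fun v : V => p + (v : E)) =
      (fun v : V => p + (v : E)) ∘ (fun v : V => v + ⟨e, he⟩) := by
    ext v
    simp [add_assoc]
  rw [h2, ← Measure.map_map (measurable_const_add_coe V p) (measurable_add_const _),
    map_add_right_eq_self]

/-- Seen inside its own direction space, `C` is convex and spanning, so it has interior points and
positive Haar measure; compactness makes the measure finite. Hence the normalization is legitimate.
-/
theorem isProbabilityMeasure_uniformOnConvex {C : Set E} (hC : Convex ℝ C) (hCc : IsCompact C)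
    {p : E} (hp : p ∈ C) : IsProbabilityMeasure (uniformOnConvex C p) := by
  set V := vectorSpan ℝ C with hV
  set S : Set V := (fun v : V => p + (v : E)) ⁻¹' C with hS
  have himg : ∀ c ∈ C, c - p ∈ V := fun c hc => vsub_mem_vectorSpan ℝ hc hp
  have hSc : IsCompact S := by
    have hclosed : Topology.IsClosedEmbedding fun v : V => p + (v : E) :=
      (Homeomorph.addLeft p).isClosedEmbedding.comp
        (Submodule.closed_of_finiteDimensional V).isClosedEmbedding_subtypeVal
    exact hclosed.isCompact_preimage hCc
  have hSconv : Convex ℝ S := by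
    intro u hu v hv a b ha hb hab
    have := hC hu hv ha hb hab
    simp only [hS, Set.mem_preimage] at this ⊢
    convert this using 1
    push_cast
    rw [smul_add, smul_add, add_add_add_comm, ← add_smul, hab, one_smul]
  have h0 : (0 : V) ∈ S := by simpa [hS] using hp
  have hspan : affineSpan ℝ S = ⊤ := by
    rw [AffineSubspace.affineSpan_eq_top_iff_vectorSpan_eq_top_of_nonempty ℝ V V ⟨0, h0⟩,
      vectorSpan_eq_span_vsub_set_right ℝ h0, ← Submodule.map_injective_of_injective
        (f := V.subtype) V.injective_subtype |>.eq_iff, Submodule.map_span, Submodule.map_top,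
      Submodule.range_subtype]
    refine Eq.trans ?_ (vectorSpan_eq_span_vsub_set_right ℝ hp).symm
    congr 1
    ext e
    simp only [Set.mem_image, vsub_eq_sub, sub_zero]
    constructor
    · rintro ⟨v, ⟨u, hu, rfl⟩, rfl⟩
      exact ⟨p + (u : E), hu, by simp⟩
    · rintro ⟨c, hc, rfl⟩
      refine ⟨⟨c - p, himg c hc⟩, ⟨_, ?_, rfl⟩, rfl⟩
      simpa [hS] using hc
  have hpos : (Measure.addHaar : Measure V) S ≠ 0 :=
    ((isOpen_interior.measure_pos _ (hSconv.interior_nonempty_iff_affineSpan_eq_top.2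
      hspan)).trans_le (measure_mono interior_subset)).ne'
  have hval : affineHaar V p C = Measure.addHaar S :=
    Measure.map_apply (measurable_const_add_coe V p) hCc.isClosed.measurableSet
  exact ProbabilityTheory.cond_isProbabilityMeasure_of_finite (μ := affineHaar V p) (hval ▸ hpos)
    (hval ▸ hSc.measure_lt_top.ne)

/-- If the coordinate is free at some point of `C`, moving it to both ends of its range stays in
`C`. The difference is a nonzero multiple of the coordinate vector, which therefore lies in the
direction space, where Haar measure is translation invariant. -/
theorem Site.invariant_uniformOnConvex {ι : Type*} [Fintype ι] [DecidableEq ι]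
    {R : ι → ι → Prop} [DecidableRel R] (s : Site R) {C : Set (ι → ℝ)} (p : ι → ℝ)
    (hCm : MeasurableSet C) (hC : C ⊆ orderCone R)
    (hup : ∀ y ∈ C, ∀ c, s.lo y ≤ c → c ≤ s.hi y → Function.update y s.idx c ∈ C) :
    s.Invariant (uniformOnConvex C p) := by
  refine s.invariant_cond (affineHaar (vectorSpan ℝ C) p) hCm hC hup ?_
  rintro ⟨y, hy, hlt⟩ r
  refine map_add_affineHaar p ?_
  have h1 := vsub_mem_vectorSpan ℝ (hup y hy _ hlt.le le_rfl) (hup y hy _ le_rfl hlt.le)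
  have h2 : Pi.single s.idx r = (r / (s.hi y - s.lo y)) •
      (Function.update y s.idx (s.hi y) -ᵥ Function.update y s.idx (s.lo y)) := by
    ext q
    by_cases hq : q = s.idx
    · subst hq
      simp [div_mul_cancel₀ r (sub_pos.2 hlt).ne']
    · simp [hq]
  rw [h2]
  exact Submodule.smul_mem _ _ h1

end UniformOnConvex

/-! ### The Gelfand-Tsetlin cone as an order cone -/

section GTOrder

variable {n : ℕ}

theorem GTIndex.ext_val {p q : GTIndex n} (h1 : p.1.val = q.1.val) (h2 : p.2.val = q.2.val) :
    p = q := by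
  obtain ⟨⟨i, hi⟩, ⟨j, hj⟩⟩ := p
  obtain ⟨⟨i', hi'⟩, ⟨j', hj'⟩⟩ := q
  simp only at h1 h2
  subst h1 h2
  rfl

/-- `Below p q` says that the interlacing conditions contain the inequality `y p ≤ y q`. -/
def Below (p q : GTIndex n) : Prop :=
  (p.1.val = q.1.val + 1 ∧ p.2.val = q.2.val) ∨
    (q.1.val = p.1.val + 1 ∧ q.2.val = p.2.val + 1)

instance : DecidableRel (Below (n := n)) := fun p q => by
  unfold Below
  infer_instance

theorem row_eq {α : Type*} (y : GTIndex n → α) {k : ℕ} (hk : k ≤ n) (i : Fin k) {q : GTIndex n}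
    (h1 : q.1.val + 1 = k) (h2 : q.2.val = i.val) : row y k hk i = y q := by
  unfold row
  congr 1
  exact GTIndex.ext_val (by simp only; omega) h2.symm

/-- Stated for a general preorder because it serves both real patterns and integer ones. -/
theorem gtCone_aux_iff {α : Type*} [Preorder α] (y : GTIndex n → α) :
    (∀ (k : ℕ) (hk : k + 1 ≤ n), Interlace (row y (k + 1) hk) (row y k (by omega))) ↔
      y ∈ orderCone Below := by
  constructor
  · rintro h p q (⟨h1, h2⟩ | ⟨h1, h2⟩)
    · have hp := p.1.isLt
      have := (h (q.1.val + 1) (by omega) q.2).1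
      rwa [row_eq y _ q.2.castSucc (q := p) (by omega) (by simpa using h2),
        row_eq y _ _ (q := q) rfl rfl] at this
    · have hq := q.1.isLt
      have := (h (p.1.val + 1) (by omega) p.2).2
      rwa [row_eq y _ p.2.succ (q := q) (by omega) (by simpa using h2),
        row_eq y _ _ (q := p) rfl rfl] at this
  · intro h k hk i
    have hi := i.isLt
    rw [row_eq y _ i.castSucc (q := ⟨⟨k, by omega⟩, ⟨i.val, by simp only; omega⟩⟩) rfl rfl,
      row_eq y _ i.succ (q := ⟨⟨k, by omega⟩, ⟨i.val + 1, by simp only; omega⟩⟩) rfl rfl,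
      row_eq y _ i (q := ⟨⟨k - 1, by omega⟩, ⟨i.val, by simp only; omega⟩⟩)
        (by simp only; omega) rfl]
    exact ⟨h _ _ (Or.inl ⟨by simp only; omega, rfl⟩), h _ _ (Or.inr ⟨by simp only; omega, rfl⟩)⟩

theorem gtCone_eq_orderCone : gtCone n = orderCone Below := by
  ext y
  exact gtCone_aux_iff y

theorem Below.irrefl (p : GTIndex n) : ¬ Below p p := by
  rintro (⟨h, -⟩ | ⟨h, -⟩) <;> omega

/-- An entry outside of the top row. -/
def gtSite (q : GTIndex n) (hq : q.1.val + 1 < n) : Site (Below (n := n)) where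
  idx := q
  below := ⟨⟨⟨q.1.val + 1, hq⟩, ⟨q.2.val, by have := q.2.isLt; simp only; omega⟩⟩,
    Finset.mem_filter.2 ⟨Finset.mem_univ _, Or.inl ⟨rfl, rfl⟩⟩⟩
  above := ⟨⟨⟨q.1.val + 1, hq⟩, ⟨q.2.val + 1, by have := q.2.isLt; simp only; omega⟩⟩,
    Finset.mem_filter.2 ⟨Finset.mem_univ _, Or.inr ⟨rfl, rfl⟩⟩⟩
  irrefl := Below.irrefl q

/-- The entries outside of the top row, listed in an order compatible with `Below`. -/
theorem exists_gtSite_list (n : ℕ) : ∃ l : List (Site (Below (n := n))),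
    (∀ s ∈ l, s.idx.1.val + 1 < n) ∧ (∀ q : GTIndex n, q.1.val + 1 < n → ∃ s ∈ l, s.idx = q) ∧
      l.Pairwise fun s s' => ¬ Below s'.idx s.idx := by
  -- Along both kinds of `Below` this key increases by exactly one, so sorting by it yields a linear
  -- extension.
  let key : Site (Below (n := n)) → ℤ := fun s => 2 * s.idx.2.val - s.idx.1.val
  let l₀ : List (Site (Below (n := n))) :=
    (Finset.univ : Finset {q : GTIndex n // q.1.val + 1 < n}).toList.map fun q => gtSite q.1 q.2
  have hmem (s : Site (Below (n := n))) :
      s ∈ l₀.insertionSort (fun s s' => key s ≤ key s') ↔ s ∈ l₀ :=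
    (List.perm_insertionSort _ l₀).mem_iff
  have : Std.Total fun s s' => key s ≤ key s' := ⟨fun s s' => le_total _ _⟩
  have : IsTrans _ fun s s' => key s ≤ key s' := ⟨fun _ _ _ h h' => le_trans h h'⟩
  refine ⟨l₀.insertionSort fun s s' => key s ≤ key s', fun s hs => ?_, fun q hq => ?_, ?_⟩
  · obtain ⟨q, -, rfl⟩ := List.mem_map.1 ((hmem s).1 hs)
    exact q.2
  · exact ⟨gtSite q hq, (hmem _).2 (List.mem_map.2 ⟨⟨q, hq⟩, by simp, rfl⟩), rfl⟩
  · refine (List.pairwise_insertionSort _ l₀).imp fun {s s'} h => ?_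
    simp only [key] at h
    rintro (⟨h1, h2⟩ | ⟨h1, h2⟩) <;> omega

theorem exists_topRow_le {α : Type*} [Preorder α] {y : GTIndex n → α} (hy : y ∈ orderCone Below)
    (q : GTIndex n) : (∃ i, topRow y i ≤ y q) ∧ ∃ i, y q ≤ topRow y i := by
  obtain ⟨d, hd⟩ : ∃ d, q.1.val + 1 + d = n := ⟨n - (q.1.val + 1), by have := q.1.isLt; omega⟩
  induction d generalizing q with
  | zero =>
    have e : topRow y ⟨q.2.val, by have := q.2.isLt; omega⟩ = y q :=
      row_eq y _ _ (by omega) rfl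
    exact ⟨⟨_, e.le⟩, ⟨_, e.ge⟩⟩
  | succ d ih =>
    have h2 := q.2.isLt
    obtain ⟨i, hi⟩ := (ih ⟨⟨q.1.val + 1, by omega⟩, ⟨q.2.val, by simp only; omega⟩⟩
      (by simp only; omega)).1
    obtain ⟨i', hi'⟩ := (ih ⟨⟨q.1.val + 1, by omega⟩, ⟨q.2.val + 1, by simp only; omega⟩⟩
      (by simp only; omega)).2
    exact ⟨⟨i, hi.trans (hy _ _ (Or.inl ⟨rfl, rfl⟩))⟩, ⟨i', (hy _ _ (Or.inr ⟨rfl, rfl⟩)).trans hi'⟩⟩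

theorem monotone_topRow {y : GTIndex n → ℝ} (hy : y ∈ gtCone n) : Monotone (topRow y) := by
  rcases n with _ | m
  · exact fun i => i.elim0
  · exact Fin.monotone_iff_le_succ.2 fun i => (hy m le_rfl i).1.trans (hy m le_rfl i).2

theorem continuous_topRow : Continuous (topRow : (GTIndex n → ℝ) → Fin n → ℝ) :=
  continuous_pi fun _ => continuous_apply _

theorem continuous_basePattern : Continuous (basePattern : (Fin n → ℝ) → GTIndex n → ℝ) :=
  continuous_pi fun _ => continuous_apply _

theorem isClosed_gtCone : IsClosed (gtCone n) := by
  rw [gtCone_eq_orderCone]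
  simp only [orderCone, Set.ofPred_forall]
  exact isClosed_iInter fun p => isClosed_iInter fun q => isClosed_iInter fun _ =>
    isClosed_le (continuous_apply p) (continuous_apply q)

theorem isClosed_gtPolytope (x : Fin n → ℝ) : IsClosed (gtPolytope x) :=
  isClosed_gtCone.inter (isClosed_singleton.preimage continuous_topRow)

theorem abs_le_norm_of_mem_gtPolytope {x : Fin n → ℝ} {y : GTIndex n → ℝ}
    (hy : y ∈ gtPolytope x) (q : GTIndex n) : |y q| ≤ ‖x‖ := by
  obtain ⟨h, rfl⟩ := hy
  rw [gtCone_eq_orderCone] at h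
  obtain ⟨⟨i, hi⟩, ⟨i', hi'⟩⟩ := exists_topRow_le h q
  have h1 := abs_le.1 ((Real.norm_eq_abs _).symm.trans_le (norm_le_pi_norm (topRow y) i))
  have h2 := abs_le.1 ((Real.norm_eq_abs _).symm.trans_le (norm_le_pi_norm (topRow y) i'))
  exact abs_le.2 ⟨h1.1.trans hi, hi'.trans h2.2⟩

theorem isCompact_gtPolytope (x : Fin n → ℝ) : IsCompact (gtPolytope x) := by
  refine Metric.isCompact_of_isClosed_isBounded (isClosed_gtPolytope x)
    (isBounded_iff_forall_norm_le.2 ⟨‖x‖, fun y hy => ?_⟩)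
  exact (pi_norm_le_iff_of_nonneg (norm_nonneg _)).2 fun q => abs_le_norm_of_mem_gtPolytope hy q

theorem convex_gtPolytope (x : Fin n → ℝ) : Convex ℝ (gtPolytope x) := by
  rintro u ⟨hu, hu'⟩ v ⟨hv, hv'⟩ a b ha hb hab
  rw [gtCone_eq_orderCone] at hu hv
  refine ⟨?_, ?_⟩
  · rw [gtCone_eq_orderCone]
    intro p q hpq
    have h1 := mul_le_mul_of_nonneg_left (hu p q hpq) ha
    have h2 := mul_le_mul_of_nonneg_left (hv p q hpq) hb
    simpa using add_le_add h1 h2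
  · ext i
    have h1 : u _ = x i := congrFun hu' i
    have h2 : v _ = x i := congrFun hv' i
    simp only [topRow, row, Pi.add_apply, Pi.smul_apply, smul_eq_mul]
    rw [h1, h2, ← add_mul, hab, one_mul]

theorem update_mem_gtPolytope {x : Fin n → ℝ} {s : Site (Below (n := n))}
    (hs : s.idx.1.val + 1 < n) {y : GTIndex n → ℝ} (hy : y ∈ gtPolytope x) {c : ℝ}
    (h1 : s.lo y ≤ c) (h2 : c ≤ s.hi y) : Function.update y s.idx c ∈ gtPolytope x := by
  obtain ⟨hy, rfl⟩ := hy
  refine ⟨?_, funext fun i => Function.update_of_ne (fun e => ?_) _ _⟩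
  · rw [gtCone_eq_orderCone] at hy ⊢
    exact s.update_mem_orderCone hy h1 h2
  · have h3 : n - 1 = s.idx.1.val := congrArg (fun q : GTIndex n => q.1.val) e
    omega

theorem isProbabilityMeasure_uniformGT {x : Fin n → ℝ} (hx : Monotone x) :
    IsProbabilityMeasure (uniformGT x) :=
  isProbabilityMeasure_uniformOnConvex (convex_gtPolytope x) (isCompact_gtPolytope x)
    (basePattern_mem x hx)

theorem invariant_uniformGT (x : Fin n → ℝ) {s : Site (Below (n := n))}
    (hs : s.idx.1.val + 1 < n) : s.Invariant (uniformGT x) :=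
  s.invariant_uniformOnConvex _ (isClosed_gtPolytope x).measurableSet
    (fun _ hy => gtCone_eq_orderCone ▸ hy.1) fun _ hy _ h1 h2 => update_mem_gtPolytope hs hy h1 h2

theorem ae_uniformGT_mem (x : Fin n → ℝ) : ∀ᵐ y ∂uniformGT x, y ∈ gtPolytope x :=
  ProbabilityTheory.ae_cond_mem (isClosed_gtPolytope x).measurableSet

end GTOrder

/-! ### Measures that are invariant under resampling have the continuous Gibbs property -/

section Ergodic

variable {n : ℕ} {l : List (Site (Below (n := n)))} {f : (GTIndex n → ℝ) → ℂ}

theorem iterate_sweep_spec (hf : Continuous f) {B : ℝ} (hB : ∀ y, ‖f y‖ ≤ B) (m : ℕ) :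
    Continuous ((sweep l)^[m] f) ∧ (∀ y, ‖(sweep l)^[m] f y‖ ≤ B) ∧
      ∀ ν : Measure (GTIndex n → ℝ), IsFiniteMeasure ν → (∀ s ∈ l, s.Invariant ν) →
        ∫ y, (sweep l)^[m] f y ∂ν = ∫ y, f y ∂ν := by
  induction m with
  | zero => exact ⟨hf, hB, fun _ _ _ => rfl⟩
  | succ m ih =>
    rw [Function.iterate_succ_apply']
    refine ⟨continuous_sweep l ih.1, norm_sweep_le l ih.2.1, fun ν _ hinv => ?_⟩
    rw [integral_sweep hinv ih.1 ih.2.1]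
    exact ih.2.2 ν inferInstance hinv

/-- Iterated sweeps become constant on the polytope, while their mean under the invariant uniform
measure stays that of `f`; this identifies the limiting constant. -/
theorem tendsto_iterate_sweep (hl1 : ∀ s ∈ l, s.idx.1.val + 1 < n)
    (hl2 : ∀ q : GTIndex n, q.1.val + 1 < n → ∃ s ∈ l, s.idx = q)
    (hl3 : l.Pairwise fun s s' => ¬ Below s'.idx s.idx)
    (hf : Continuous f) {B : ℝ} (hB : ∀ y, ‖f y‖ ≤ B) {x : Fin n → ℝ} {y : GTIndex n → ℝ}
    (hy : y ∈ gtPolytope x) :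
    Tendsto (fun m => (sweep l)^[m] f y) atTop (𝓝 (∫ z, f z ∂uniformGT x)) := by
  have hx : Monotone x := hy.2 ▸ monotone_topRow hy.1
  have := isProbabilityMeasure_uniformGT hx
  rw [Metric.tendsto_atTop]
  intro η hη
  have hcone {z : GTIndex n → ℝ} (hz : z ∈ gtPolytope x) : z ∈ orderCone Below :=
    gtCone_eq_orderCone (n := n) ▸ hz.1
  obtain ⟨M, hM⟩ := exists_iterate_sweep_osc_le (l := l) (C := gtPolytope x)
    (fun s hs z hz t h0 h1 => by
      have h := (s.lo_le (hcone hz)).trans (s.le_hi (hcone hz))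
      exact update_mem_gtPolytope (hl1 s hs) hz (by nlinarith) (by nlinarith))
    (isCompact_gtPolytope x) (D := 2 * ‖x‖)
    (fun s hs z hz => by
      obtain ⟨p, -, hp⟩ := s.exists_eq_lo z
      obtain ⟨p', -, hp'⟩ := s.exists_eq_hi z
      have h1 := abs_le.1 (abs_le_norm_of_mem_gtPolytope hz p)
      have h2 := abs_le.1 (abs_le_norm_of_mem_gtPolytope hz p')
      have h3 := (s.lo_le (hcone hz)).trans (s.le_hi (hcone hz))
      constructor <;> linarith)
    hl3
    (fun z hz z' hz' p hp => by
      have hpn : ¬ p.1.val + 1 < n := fun h => by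
        obtain ⟨s, hs, e⟩ := hl2 p h
        exact hp s hs e.symm
      have hp1 := p.1.isLt
      have e (u : GTIndex n → ℝ) :
          topRow u ⟨p.2.val, by have := p.2.isLt; omega⟩ = u p :=
        row_eq u _ _ (by omega) rfl
      rw [← e z, ← e z', hz.2, hz'.2])
    hf hB (half_pos hη)
  refine ⟨M, fun m hm => ?_⟩
  obtain ⟨hc, hb, hi⟩ := iterate_sweep_spec (l := l) hf hB m
  rw [← hi (uniformGT x) inferInstance fun s hs => invariant_uniformGT x (hl1 s hs), dist_eq_norm]
  have hint : Integrable ((sweep l)^[m] f) (uniformGT x) :=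
    Integrable.of_bound hc.aestronglyMeasurable B (Eventually.of_forall hb)
  have heq : (sweep l)^[m] f y - ∫ z, (sweep l)^[m] f z ∂uniformGT x =
      ∫ z, ((sweep l)^[m] f y - (sweep l)^[m] f z) ∂uniformGT x := by
    rw [integral_sub (integrable_const _) hint]
    simp
  rw [heq]
  refine lt_of_le_of_lt (norm_integral_le_of_norm_le_const (C := η / 2) ?_) ?_
  · filter_upwards [ae_uniformGT_mem x] with z hz
    exact hM m hm y hy z hz
  · simp only [probReal_univ, mul_one]
    linarith

/-- Sweeps leave the integral of `f` against `μ` unchanged and converge pointwise to the conditional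
mean given the top row; dominated convergence equates the two integrals. -/
theorem continuousGibbs_of_invariant (μ : Measure (GTIndex n → ℝ)) [IsProbabilityMeasure μ]
    (hμ : ∀ᵐ y ∂μ, y ∈ gtCone n)
    (hinv : ∀ s : Site (Below (n := n)), s.idx.1.val + 1 < n → s.Invariant μ) :
    ContinuousGibbs μ := by
  intro f
  obtain ⟨l, hl1, hl2, hl3⟩ := exists_gtSite_list n
  have hB := f.norm_coe_le_norm
  have hlim {x : Fin n → ℝ} {y : GTIndex n → ℝ} (hy : y ∈ gtPolytope x) :=
    tendsto_iterate_sweep hl1 hl2 hl3 f.continuous hB hy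
  have hspec := iterate_sweep_spec (l := l) f.continuous hB
  have hmono : ∀ᵐ x ∂μ.map topRow, Monotone x :=
    (ae_map_iff continuous_topRow.aemeasurable isClosed_monotone.measurableSet).2
      (hμ.mono fun y hy => monotone_topRow hy)
  -- Measurability in `x` comes from the sweeps as well, evaluated at the pattern `basePattern x`,
  -- which depends continuously on `x`.
  have hmeas : AEStronglyMeasurable (fun x : Fin n → ℝ => ∫ y, f y ∂uniformGT x)
      (μ.map topRow) :=
    aestronglyMeasurable_of_tendsto_ae atTop
      (fun m => ((hspec m).1.comp continuous_basePattern).aestronglyMeasurable)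
      (hmono.mono fun x hx => hlim (basePattern_mem x hx))
  have hbound : ∀ᵐ x ∂μ.map topRow, ‖∫ y, f y ∂uniformGT x‖ ≤ ‖f‖ := by
    filter_upwards [hmono] with x hx
    have := isProbabilityMeasure_uniformGT hx
    exact (norm_integral_le_of_norm_le_const (Eventually.of_forall hB)).trans (by simp)
  have : IsProbabilityMeasure (μ.map topRow) :=
    Measure.isProbabilityMeasure_map continuous_topRow.aemeasurable
  refine ⟨Integrable.of_bound hmeas _ hbound, ?_⟩
  rw [integral_map continuous_topRow.aemeasurable hmeas]
  have htend : Tendsto (fun m => ∫ y, (sweep l)^[m] f y ∂μ) atTop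
      (𝓝 (∫ y, (∫ z, f z ∂uniformGT (topRow y)) ∂μ)) :=
    tendsto_integral_of_dominated_convergence (fun _ => ‖f‖)
      (fun m => (hspec m).1.aestronglyMeasurable) (integrable_const _)
      (fun m => Eventually.of_forall (hspec m).2.1)
      (hμ.mono fun y hy => hlim ⟨hy, rfl⟩)
  have hconst (m : ℕ) : ∫ y, (sweep l)^[m] f y ∂μ = ∫ y, f y ∂μ :=
    (hspec m).2.2 μ inferInstance fun s hs => hinv s (hl1 s hs)
  simp only [hconst] at htend
  exact tendsto_nhds_unique tendsto_const_nhds htend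

end Ergodic

/-! ### The weight of a half-strict pattern -/

namespace HalfStrictGT

variable {n : ℕ}

theorem entry_injective : Function.Injective (entry : HalfStrictGT n → GTIndex n → ℤ) := by
  rintro ⟨e, h1, h2, h3⟩ ⟨e', h1', h2', h3'⟩ h
  simp only at h
  subst h
  rfl

instance : Countable (HalfStrictGT n) := entry_injective.countable

theorem mem_orderCone (m : HalfStrictGT n) : m.entry ∈ orderCone (Below (n := n)) :=
  (gtCone_aux_iff m.entry).1 m.interlace

theorem count_row (m : HalfStrictGT n) (k : ℕ) (hk : k ≤ n) (i : Fin k) :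
    m.count k hk (row m.entry k hk i) = i.val := by
  simp only [count, (m.strictMono k hk).lt_iff_lt]
  rw [show (Finset.univ.filter fun j : Fin k => j < i) = Finset.Iio i by ext; simp, Fin.card_Iio]

theorem count_zero (m : HalfStrictGT n) (k : ℕ) (hk : k ≤ n) : m.count k hk ((0 : ℕ) : ℤ) = 0 :=
  Finset.card_eq_zero.2 (Finset.filter_eq_empty_iff.2 fun i _ => not_lt.2 (m.row_nonneg k hk i))

theorem count_eq_of_topRow_lt (m : HalfStrictGT n) {x : ℤ} (hx : ∀ i, topRow m.entry i < x)
    (k : ℕ) (hk : k ≤ n) : m.count k hk x = k := by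
  unfold count
  rw [Finset.filter_true_of_mem, Finset.card_univ, Fintype.card_fin]
  intro i _
  obtain ⟨i', hi'⟩ := (exists_topRow_le m.mem_orderCone
    ⟨⟨k - 1, by have := i.isLt; omega⟩, ⟨i.val, by have := i.isLt; simp only; omega⟩⟩).2
  exact hi'.trans_lt (hx i')

theorem sum_vert (m : HalfStrictGT n) (k : Fin (n + 1)) (X : ℕ) :
    ∑ x ∈ Finset.range X, (m.toPath.vert x k).toNat = m.count k.val (by omega) X := by
  induction X with
  | zero => simpa using (m.count_zero k.val (by omega)).symm
  | succ X ih =>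
    rw [Finset.sum_range_succ, ih, Nat.cast_succ, m.count_add_one]
    rfl

theorem horiz_add_count (m : HalfStrictGT n) (j : Fin n) (x : ℕ) :
    (m.toPath.horiz x j).toNat + m.count (j.val + 1) (by omega) x =
      1 + m.count j.val (by omega) x := by
  have h1 := m.count_le j.val (by omega) x
  have h2 := m.count_le_succ j.val (by omega) x
  simp only [toPath]
  by_cases h : m.count (j.val + 1) (by omega) x = m.count j.val (by omega) x
  · rw [decide_eq_true h, h, Bool.toNat_true]
  · rw [decide_eq_false h, Bool.toNat_false]
    omega

/-- Summing `horiz_add_count` over the rows telescopes, so the number of horizontal edges depends on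
the top row only. -/
theorem sum_horiz (m : HalfStrictGT n) (X : ℕ) :
    ∑ j : Fin n, ∑ x ∈ Finset.range X, (m.toPath.horiz x j).toNat +
      ∑ x ∈ Finset.range X, m.count n le_rfl x = n * X := by
  let c : ℕ → ℕ := fun k => if hk : k ≤ n then ∑ x ∈ Finset.range X, m.count k hk x else 0
  have hc (k : ℕ) (hk : k ≤ n) : c k = ∑ x ∈ Finset.range X, m.count k hk x := dif_pos hk
  have hstep (j : Fin n) : ∑ x ∈ Finset.range X, (m.toPath.horiz x j).toNat + c (j.val + 1) =
      X + c j.val := by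
    rw [hc _ (by omega), hc _ (by omega), ← Finset.sum_add_distrib,
      Finset.sum_congr rfl fun x _ => m.horiz_add_count j x, Finset.sum_add_distrib]
    simp
  have hsum := Finset.sum_congr (s₁ := (Finset.univ : Finset (Fin n))) rfl fun j _ => hstep j
  rw [Finset.sum_add_distrib, Finset.sum_add_distrib,
    Fin.sum_univ_eq_sum_range (fun k => c (k + 1)), Fin.sum_univ_eq_sum_range c] at hsum
  have htel : ∑ k ∈ Finset.range n, c (k + 1) + c 0 = ∑ k ∈ Finset.range n, c k + c n := by
    rw [← Finset.sum_range_succ', Finset.sum_range_succ]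
  have h0 : c 0 = 0 := by
    rw [hc 0 (Nat.zero_le _)]
    exact Finset.sum_eq_zero fun x _ => by simp [count]
  rw [← hc n le_rfl]
  simp only [Finset.sum_const, Finset.card_univ, Fintype.card_fin, smul_eq_mul] at hsum
  omega

/-- The factor of an entry `c` with upper neighbours `a ≤ c ≤ b` in the weight of a pattern. -/
noncomputable def bondWeight (w : Fin 6 → ℝ) (a c b : ℤ) : ℝ :=
  if a = c then w 0 * w 1 / (w 4 * w 5) else if c = b then w 2 * w 3 / (w 4 * w 5) else 1

/-- The weight of a pattern, up to a factor that depends on its top row only. -/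
noncomputable def weight (w : Fin 6 → ℝ) (m : HalfStrictGT n) : ℝ :=
  ∏ j : Fin n, ∏ i : Fin j.val, bondWeight w (row m.entry (j.val + 1) (by omega) i.castSucc)
    (row m.entry j.val (by omega) i) (row m.entry (j.val + 1) (by omega) i.succ)

/-- The interaction of the two vertical edges at a vertex. -/
noncomputable def vertexFactor (w : Fin 6 → ℝ) : Bool × Bool × Bool × Bool → ℝ
  | (true, true, true, _) => w 0 * w 1 / (w 4 * w 5)
  | (true, false, true, _) => w 2 * w 3 / (w 4 * w 5)
  | _ => 1

/-- Conservation eliminates the outgoing horizontal edge. The factors of the other three edges are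
fitted so that the interaction is trivial except where a path goes up through the vertex from below.
-/
theorem vertexWeight_eq {w : Fin 6 → ℝ} (hw : ∀ r, 0 < w r) (ω : PathConfig n) (v : ℕ × Fin n) :
    vertexWeight w (ω.at v) =
      w 0 * (w 4 / w 0) ^ (ω.vert v.1 v.2.castSucc).toNat *
        (w 3 / w 0) ^ (ω.horiz v.1 v.2).toNat * (w 5 / w 3) ^ (ω.vert v.1 v.2.succ).toNat *
        vertexFactor w (ω.at v) := by
  have h := ω.conserve v.1 v.2
  have h0 := (hw 0).ne'
  have h3 := (hw 3).ne'
  have h4 := (hw 4).ne'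
  have h5 := (hw 5).ne'
  simp only [PathConfig.at]
  generalize ω.vert v.1 v.2.castSucc = i₁ at *
  generalize ω.horiz v.1 v.2 = j₁ at *
  generalize ω.vert v.1 v.2.succ = i₂ at *
  generalize ω.horiz (v.1 + 1) v.2 = j₂ at *
  cases i₁ <;> cases j₁ <;> cases i₂ <;> cases j₂ <;>
    first
      | (simp at h; done)
      | (simp only [vertexWeight, vertexFactor, Bool.toNat_true, Bool.toNat_false, pow_zero,
          pow_one, mul_one]
         try field_simp)

/-- A nontrivial factor needs an entry of the lower row to recur in the upper row, and by strict
monotonicity it then equals one of its two upper neighbours. The incoming horizontal edge is present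
for the left neighbour and absent for the right one. -/
theorem prod_vertexFactor (w : Fin 6 → ℝ) (m : HalfStrictGT n) (j : Fin n) {X : ℕ}
    (hX : ∀ i, topRow m.entry i < X) :
    ∏ x ∈ Finset.range X, vertexFactor w (m.toPath.at (x, j)) =
      ∏ i : Fin j.val, bondWeight w (row m.entry (j.val + 1) (by omega) i.castSucc)
        (row m.entry j.val (by omega) i) (row m.entry (j.val + 1) (by omega) i.succ) := by
  have hj : j.val ≤ n := by omega
  have hj1 : j.val + 1 ≤ n := by omega
  have hnn (i : Fin j.val) : ((row m.entry j.val hj i).toNat : ℤ) = row m.entry j.val hj i :=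
    Int.toNat_of_nonneg (m.row_nonneg _ _ i)
  have hinj : Function.Injective fun i : Fin j.val => (row m.entry j.val hj i).toNat := by
    intro i i' h
    refine (m.strictMono j.val hj).injective ?_
    simp only at h
    rw [← hnn i, ← hnn i', h]
  have hsub : Finset.univ.image (fun i : Fin j.val => (row m.entry j.val hj i).toNat) ⊆
      Finset.range X := by
    intro x hx
    obtain ⟨i, -, rfl⟩ := Finset.mem_image.1 hx
    obtain ⟨i', hi'⟩ := (exists_topRow_le m.mem_orderCone
      ⟨⟨j.val - 1, by omega⟩, ⟨i.val, by have := i.isLt; simp only; omega⟩⟩).2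
    have h1 := hX i'
    have h2 : row m.entry j.val hj i < X := hi'.trans_lt h1
    have := hnn i
    rw [Finset.mem_range]
    omega
  rw [← Finset.prod_subset hsub, Finset.prod_image hinj.injOn]
  · refine Finset.prod_congr rfl fun i _ => ?_
    have hv : m.toPath.vert (row m.entry j.val hj i).toNat j.castSucc = true :=
      decide_eq_true ⟨i, (hnn i).symm⟩
    have hcount := m.count_row j.val hj i
    have hint := m.interlace j.val hj1 i
    simp only [PathConfig.at, hv, bondWeight]
    by_cases ha : row m.entry (j.val + 1) hj1 i.castSucc = row m.entry j.val hj i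
    · have hv' : m.toPath.vert (row m.entry j.val hj i).toNat j.succ = true :=
        decide_eq_true ⟨i.castSucc, ha.trans (hnn i).symm⟩
      have hh : m.toPath.horiz (row m.entry j.val hj i).toNat j = true := by
        refine decide_eq_true ?_
        rw [hnn, hcount, ← ha, m.count_row]
        rfl
      rw [hv', hh, if_pos ha]
      rfl
    · rw [if_neg ha]
      by_cases hb : row m.entry j.val hj i = row m.entry (j.val + 1) hj1 i.succ
      · have hv' : m.toPath.vert (row m.entry j.val hj i).toNat j.succ = true :=
          decide_eq_true ⟨i.succ, hb.symm.trans (hnn i).symm⟩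
        have hh : m.toPath.horiz (row m.entry j.val hj i).toNat j = false := by
          refine decide_eq_false ?_
          rw [hnn, hcount, hb, m.count_row, Fin.val_succ]
          omega
        rw [hv', hh, if_pos hb]
        rfl
      · have hv' : m.toPath.vert (row m.entry j.val hj i).toNat j.succ = false := by
          refine decide_eq_false ?_
          rintro ⟨i', hi'⟩
          rw [hnn] at hi'
          have h1 : row m.entry (j.val + 1) hj1 i.castSucc < row m.entry (j.val + 1) hj1 i' :=
            hi' ▸ lt_of_le_of_ne hint.1 ha
          have h2 : row m.entry (j.val + 1) hj1 i' < row m.entry (j.val + 1) hj1 i.succ :=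
            hi' ▸ lt_of_le_of_ne hint.2 hb
          have h3 := (m.strictMono _ hj1).lt_iff_lt.1 h1
          have h4 := (m.strictMono _ hj1).lt_iff_lt.1 h2
          rw [Fin.lt_def] at h3 h4
          simp only [Fin.val_castSucc, Fin.val_succ] at h3 h4
          omega
        rw [hv', if_neg hb]
        cases m.toPath.horiz (row m.entry j.val hj i).toNat j <;> rfl
  · intro x _ hx
    have hv : m.toPath.vert x j.castSucc = false := by
      refine decide_eq_false ?_
      rintro ⟨i, hi⟩
      refine hx (Finset.mem_image.2 ⟨i, Finset.mem_univ _, ?_⟩)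
      exact (congrArg Int.toNat hi).trans (Int.toNat_natCast x)
    simp only [PathConfig.at, hv]
    rfl

/-- Left of column `X`, row `j` has `j` vertical edges entering and `j + 1` leaving, and the total
number of horizontal edges is fixed by `l`; all one-edge factors go into `K`. -/
theorem exists_weightIn_toPath_eq {w : Fin 6 → ℝ} (hw : ∀ r, 0 < w r) (l : Fin n → ℤ) {X : ℕ}
    (hX : ∀ i, l i < X) :
    ∃ K : ℝ, ∀ m : HalfStrictGT n, topRow m.entry = l →
      weightIn w (Finset.range X ×ˢ Finset.univ) m.toPath = K * m.weight w := by
  let N := ∑ x ∈ Finset.range X, (Finset.univ.filter fun i : Fin n => l i < (x : ℤ)).card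
  refine ⟨(∏ j : Fin n, (w 0 ^ X * (w 4 / w 0) ^ j.val)) * (w 3 / w 0) ^ (n * X - N) *
    ∏ j : Fin n, (w 5 / w 3) ^ (j.val + 1), ?_⟩
  rintro m rfl
  have hV (k : Fin (n + 1)) : ∑ x ∈ Finset.range X, (m.toPath.vert x k).toNat = k.val := by
    rw [m.sum_vert, m.count_eq_of_topRow_lt hX]
  have hH : ∑ j : Fin n, ∑ x ∈ Finset.range X, (m.toPath.horiz x j).toNat = n * X - N :=
    Nat.eq_sub_of_add_eq (m.sum_horiz X)
  rw [weightIn, Finset.prod_product_right]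
  simp only [vertexWeight_eq hw, Finset.prod_mul_distrib, Finset.prod_pow_eq_pow_sum,
    Finset.prod_const, Finset.card_range, hV, m.prod_vertexFactor w _ hX]
  rw [hH, weight]
  simp only [Fin.val_castSucc, Fin.val_succ]

theorem exists_weight_bounds {w : Fin 6 → ℝ} (hw : ∀ r, 0 < w r) (n : ℕ) :
    ∃ c₁ c₂ : ℝ, 0 < c₁ ∧ ∀ m : HalfStrictGT n, c₁ ≤ m.weight w ∧ m.weight w ≤ c₂ := by
  have hα : 0 < w 0 * w 1 / (w 4 * w 5) := div_pos (mul_pos (hw _) (hw _)) (mul_pos (hw _) (hw _))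
  have hβ : 0 < w 2 * w 3 / (w 4 * w 5) := div_pos (mul_pos (hw _) (hw _)) (mul_pos (hw _) (hw _))
  set α := w 0 * w 1 / (w 4 * w 5) with hαdef
  set β := w 2 * w 3 / (w 4 * w 5) with hβdef
  have hb (a c b : ℤ) : min (min α β) 1 ≤ bondWeight w a c b ∧
      bondWeight w a c b ≤ max (max α β) 1 := by
    unfold bondWeight
    rw [← hαdef, ← hβdef]
    split_ifs <;> simp
  have hmin : 0 < min (min α β) 1 := lt_min (lt_min hα hβ) one_pos
  refine ⟨∏ j : Fin n, ∏ _i : Fin j.val, min (min α β) 1,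
    ∏ j : Fin n, ∏ _i : Fin j.val, max (max α β) 1,
    Finset.prod_pos fun j _ => Finset.prod_pos fun _ _ => hmin, fun m => ⟨?_, ?_⟩⟩
  · exact Finset.prod_le_prod (fun j _ => Finset.prod_nonneg fun _ _ => hmin.le) fun j _ =>
      Finset.prod_le_prod (fun _ _ => hmin.le) fun i _ => (hb _ _ _).1
  · exact Finset.prod_le_prod
      (fun j _ => Finset.prod_nonneg fun _ _ => hmin.le.trans (hb _ _ _).1) fun j _ =>
      Finset.prod_le_prod (fun _ _ => hmin.le.trans (hb _ _ _).1) fun i _ => (hb _ _ _).2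

/-- The entry at the site lies strictly between the bounds given by its neighbours. -/
def Interior (m : HalfStrictGT n) (s : Site (Below (n := n))) : Prop :=
  s.lo m.entry < m.entry s.idx ∧ m.entry s.idx < s.hi m.entry

theorem entry_eq_entry_iff_of_interior {s : Site (Below (n := n))} {m m' : HalfStrictGT n}
    (h : ∀ p, p ≠ s.idx → m.entry p = m'.entry p) (hm : m.Interior s) (hm' : m'.Interior s)
    {p q : GTIndex n} (hpq : Below p q) : m.entry p = m.entry q ↔ m'.entry p = m'.entry q := by
  have key (m : HalfStrictGT n) (hm : m.Interior s) (he : p = s.idx ∨ q = s.idx) :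
      m.entry p ≠ m.entry q := by
    rcases he with rfl | rfl
    · exact (hm.2.trans_le (s.hi_le hpq)).ne
    · exact ((s.le_lo hpq).trans_lt hm.1).ne
  by_cases he : p = s.idx ∨ q = s.idx
  · exact iff_of_false (key m hm he) (key m' hm' he)
  · rw [not_or] at he
    rw [h p he.1, h q he.2]

/-- The weight sees only coincidences of neighbouring entries, and an entry strictly between its
bounds takes part in none. -/
theorem weight_eq_of_interior (w : Fin 6 → ℝ) {s : Site (Below (n := n))} {m m' : HalfStrictGT n}
    (h : ∀ p, p ≠ s.idx → m.entry p = m'.entry p) (hm : m.Interior s) (hm' : m'.Interior s) :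
    m.weight w = m'.weight w := by
  refine Finset.prod_congr rfl fun j _ => Finset.prod_congr rfl fun i _ => ?_
  have hi := i.isLt
  have hj := j.isLt
  have e1 (m : HalfStrictGT n) := row_eq m.entry (k := j.val + 1) (by omega) i.castSucc
    (q := ⟨j, ⟨i.val, by omega⟩⟩) rfl rfl
  have e2 (m : HalfStrictGT n) := row_eq m.entry (k := j.val) (by omega) i
    (q := ⟨⟨j.val - 1, by omega⟩, ⟨i.val, by simp only; omega⟩⟩) (by simp only; omega) rfl
  have e3 (m : HalfStrictGT n) := row_eq m.entry (k := j.val + 1) (by omega) i.succ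
    (q := ⟨j, ⟨i.val + 1, by omega⟩⟩) rfl rfl
  simp only [e1, e2, e3, bondWeight]
  rw [if_congr (entry_eq_entry_iff_of_interior h hm hm' ?_) rfl
    (if_congr (entry_eq_entry_iff_of_interior h hm hm' ?_) rfl rfl)]
  · exact Or.inl ⟨by simp only; omega, rfl⟩
  · exact Or.inr ⟨by simp only; omega, rfl⟩

/-! ### Gibbs measures on half-strict patterns -/

theorem toPath_injective : Function.Injective (toPath : HalfStrictGT n → PathConfig n) := by
  intro m m' h
  have hsub (m m' : HalfStrictGT n) (h : m.toPath = m'.toPath) (k : ℕ) (hk : k ≤ n) :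
      Set.range (row m.entry k hk) ⊆ Set.range (row m'.entry k hk) := by
    rintro _ ⟨i, rfl⟩
    have hnn : ((row m.entry k hk i).toNat : ℤ) = row m.entry k hk i :=
      Int.toNat_of_nonneg (m.row_nonneg k hk i)
    have h1 : m.toPath.vert (row m.entry k hk i).toNat ⟨k, by omega⟩ = true :=
      decide_eq_true ⟨i, hnn.symm⟩
    rw [h] at h1
    obtain ⟨i', hi'⟩ := of_decide_eq_true h1
    exact ⟨i', hi'.trans hnn⟩
  refine entry_injective (funext fun q => ?_)
  have hk : q.1.val + 1 ≤ n := q.1.isLt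
  have hrow := (m.strictMono _ hk).range_inj (m'.strictMono _ hk) |>.1
    ((hsub m m' h _ hk).antisymm (hsub m' m h.symm _ hk))
  exact congrFun hrow q.2

theorem at_toPath_eq_of_topRow_lt {m : HalfStrictGT n} {x : ℕ} (hx : ∀ i, topRow m.entry i < x)
    (j : Fin n) : m.toPath.at (x, j) = (false, false, false, false) := by
  have hx1 : ∀ i, topRow m.entry i < ((x + 1 : ℕ) : ℤ) := fun i => by
    have := hx i
    push_cast
    omega
  have hv (k : Fin (n + 1)) : m.toPath.vert x k = false := by
    refine decide_eq_false ?_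
    rintro ⟨i, hi⟩
    have hk := k.isLt
    obtain ⟨i', hi'⟩ := (exists_topRow_le m.mem_orderCone
      ⟨⟨k.val - 1, by have := i.isLt; omega⟩, ⟨i.val, by have := i.isLt; simp only; omega⟩⟩).2
    exact ((hi'.trans_lt (hx i')).ne hi).elim
  have hh (x : ℕ) (hx : ∀ i, topRow m.entry i < x) : m.toPath.horiz x j = false := by
    refine decide_eq_false ?_
    rw [m.count_eq_of_topRow_lt hx, m.count_eq_of_topRow_lt hx]
    omega
  simp only [PathConfig.at, hv, hh x hx, hh (x + 1) hx1]

theorem toPath_mem_pathsWithTop (m : HalfStrictGT n) :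
    m.toPath ∈ pathsWithTop (topRow m.entry) := fun _ => decide_eq_true_iff

/-- The probability of a pattern is its weight times a function of its top row. -/
theorem exists_measureReal_singleton_eq {w : Fin 6 → ℝ} (hw : ∀ r, 0 < w r)
    {ρ : Measure (HalfStrictGT n)} [IsFiniteMeasure ρ] (hρ : SixVertexGibbs w ρ) (l : Fin n → ℤ) :
    ∃ K : ℝ, 0 ≤ K ∧ ∀ m : HalfStrictGT n, topRow m.entry = l → ρ.real {m} = K * m.weight w := by
  obtain ⟨c₁, c₂, hc₁, hc⟩ := exists_weight_bounds hw n
  set S : Set (HalfStrictGT n) := {m | topRow m.entry = l} with hS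
  by_cases hnull : ρ S = 0
  · refine ⟨0, le_rfl, fun m hm => ?_⟩
    have hmS : m ∈ S := hm
    rw [zero_mul, measureReal_def, measure_mono_null (Set.singleton_subset_iff.2 hmS) hnull,
      ENNReal.toReal_zero]
  obtain ⟨m₀, hm₀, hρm₀⟩ : ∃ m₀ ∈ S, ρ {m₀} ≠ 0 := by
    by_contra! hcon
    refine hnull ?_
    rw [← Set.biUnion_of_singleton S]
    exact (measure_biUnion_null_iff (Set.to_countable S)).2 hcon
  obtain ⟨X, hX⟩ : ∃ X : ℕ, ∀ i, l i < X := by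
    obtain ⟨B, hB⟩ := Finite.bddAbove_range l
    refine ⟨(B + 1).toNat, fun i => ?_⟩
    have : l i ≤ B := hB ⟨i, rfl⟩
    omega
  obtain ⟨K, hK⟩ := exists_weightIn_toPath_eq hw l hX
  -- All patterns with top row `l` are empty outside this box, so conditioning on the exterior does
  -- not separate them.
  set Λ : Finset (ℕ × Fin n) := Finset.range X ×ˢ Finset.univ
  set ν : Measure (PathConfig n) := (ρ[|S]).map toPath with hν
  set A := agreeOff (pathsWithTop l) Λ m₀.toPath with hA
  have hmem (m : HalfStrictGT n) (hm : m ∈ S) : m.toPath ∈ A := by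
    have hm' : topRow m.entry = l := hm
    have hm₀' : topRow m₀.entry = l := hm₀
    refine ⟨hm' ▸ m.toPath_mem_pathsWithTop, fun v hv => ?_⟩
    obtain ⟨x, j⟩ := v
    have hx : X ≤ x := by
      by_contra hlt
      exact hv (Finset.mem_product.2 ⟨Finset.mem_range.2 (not_le.1 hlt), Finset.mem_univ _⟩)
    have hlx : ∀ i, l i < x := fun i => (hX i).trans_le (by exact_mod_cast hx)
    rw [at_toPath_eq_of_topRow_lt (hm'.symm ▸ hlx), at_toPath_eq_of_topRow_lt (hm₀'.symm ▸ hlx)]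
  have hpt (m : HalfStrictGT n) (hm : m ∈ S) : ν {m.toPath} = (ρ S)⁻¹ * ρ {m} := by
    have hpre : toPath ⁻¹' {m.toPath} = {m} := by
      ext m'
      exact toPath_injective.eq_iff
    rw [hν, Measure.map_apply Measurable.of_discrete (MeasurableSet.of_discrete), hpre,
      ProbabilityTheory.cond_apply MeasurableSet.of_discrete,
      Set.inter_eq_right.2 (Set.singleton_subset_iff.2 hm)]
  have hSfin : ρ S ≠ ⊤ := measure_ne_top _ _
  have hνA : ν A ≠ 0 := by
    intro h
    have h1 : ν {m₀.toPath} = 0 :=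
      measure_mono_null (Set.singleton_subset_iff.2 (hmem m₀ hm₀)) h
    rw [hpt m₀ hm₀, mul_eq_zero] at h1
    exact h1.elim (fun h => (ENNReal.inv_ne_zero.2 hSfin) h) hρm₀
  have hνprob : IsFiniteMeasure ν := by
    have : IsProbabilityMeasure (ρ[|S]) := ProbabilityTheory.cond_isProbabilityMeasure hnull
    infer_instance
  obtain ⟨c, hcond⟩ := hρ l hnull Λ m₀.toPath (hmem m₀ hm₀).1 hνA
  have hval (m : HalfStrictGT n) (hm : topRow m.entry = l) :
      ρ.real {m} = ρ.real S * ν.real A * c * K * m.weight w := by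
    have h1 := hcond m.toPath (hmem m hm)
    rw [hK m hm, measureReal_def, ProbabilityTheory.cond_apply MeasurableSet.of_discrete,
      Set.inter_eq_right.2 (Set.singleton_subset_iff.2 (hmem m hm)), hpt m hm,
      ENNReal.toReal_mul, ENNReal.toReal_mul, ENNReal.toReal_inv, ENNReal.toReal_inv,
      ← measureReal_def, ← measureReal_def, ← measureReal_def] at h1
    have hS0 : ρ.real S ≠ 0 := ENNReal.toReal_ne_zero.2 ⟨hnull, hSfin⟩
    have hA0 : ν.real A ≠ 0 := ENNReal.toReal_ne_zero.2 ⟨hνA, measure_ne_top _ _⟩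
    calc ρ.real {m} = ρ.real S * ν.real A * ((ν.real A)⁻¹ * ((ρ.real S)⁻¹ * ρ.real {m})) := by
          field_simp
      _ = _ := by
          rw [h1]
          ring
  -- The Gibbs property does not prescribe the sign of `c`; it is read off at `m₀`, whose weight is
  -- positive.
  refine ⟨_, ?_, hval⟩
  have h2 := hval m₀ hm₀
  by_contra hneg
  have h3 := mul_neg_of_neg_of_pos (not_le.1 hneg) (hc₁.trans_le (hc m₀).1)
  rw [← h2] at h3
  exact absurd measureReal_nonneg (not_le.2 h3)

end HalfStrictGT

/-! ### Discrete and continuous averages over one entry -/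

/-- Riemann sum comparison: each of the `N` unit cells contributes an error of at most `κ`. -/
theorem abs_sum_sub_integral_le {ψ : ℝ → ℝ} {κ : ℝ} (hψc : Continuous ψ)
    (hψ : ∀ u v, |ψ u - ψ v| ≤ κ * |u - v|) (N : ℕ) :
    |∑ k ∈ Finset.range N, (ψ k - ∫ t in (0 : ℝ)..1, ψ (t * N))| ≤ κ * N := by
  rcases Nat.eq_zero_or_pos N with rfl | hN
  · simp
  have hN0 : (N : ℝ) ≠ 0 := by positivity
  have hcell (k : ℕ) : |ψ k - ∫ u in (k : ℝ)..(k + 1 : ℕ), ψ u| ≤ κ := by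
    have h1 : ψ k - ∫ u in (k : ℝ)..(k + 1 : ℕ), ψ u =
        ∫ u in (k : ℝ)..(k + 1 : ℕ), (ψ k - ψ u) := by
      rw [intervalIntegral.integral_sub (by simp) (hψc.intervalIntegrable _ _)]
      simp
    rw [h1, ← Real.norm_eq_abs]
    refine (intervalIntegral.norm_integral_le_of_norm_le_const (C := κ) fun u hu => ?_).trans
      (by simp)
    rw [Set.uIoc_of_le (by simp)] at hu
    rw [Real.norm_eq_abs]
    refine (hψ _ _).trans ?_
    have hκ : 0 ≤ κ := by
      have := (abs_nonneg _).trans (hψ 1 0)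
      simpa using this
    have h2 : |(k : ℝ) - u| ≤ 1 := by
      have := hu.2
      push_cast at this
      rw [abs_le]
      constructor <;> linarith [hu.1]
    nlinarith
  have hsum : ∑ k ∈ Finset.range N, ∫ u in (k : ℝ)..(k + 1 : ℕ), ψ u =
      N * ∫ t in (0 : ℝ)..1, ψ (t * N) := by
    rw [intervalIntegral.sum_integral_adjacent_intervals (a := fun k : ℕ => (k : ℝ))
      fun k _ => hψc.intervalIntegrable _ _, intervalIntegral.integral_comp_mul_right _ hN0]
    simp [hN0]
  have hrw : ∑ k ∈ Finset.range N, (ψ k - ∫ t in (0 : ℝ)..1, ψ (t * N)) =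
      ∑ k ∈ Finset.range N, (ψ k - ∫ u in (k : ℝ)..(k + 1 : ℕ), ψ u) := by
    rw [Finset.sum_sub_distrib, Finset.sum_sub_distrib, hsum]
    simp
  rw [hrw]
  refine (Finset.abs_sum_le_sum_abs _ _).trans
    ((Finset.sum_le_sum fun k _ => hcell k).trans (le_of_eq ?_))
  simp [mul_comm]

/-- A probability on an interval of integers that is uniform in the interior, and not too large at
the ends, is close to the uniform measure on the real interval. -/
theorem abs_sum_mul_sub_integral_le {ψ : ℝ → ℝ} {κ B Q : ℝ} (hψc : Continuous ψ)
    (hψ : ∀ u v, |ψ u - ψ v| ≤ κ * |u - v|) (hB : ∀ u, |ψ u| ≤ B) (hQ : 1 ≤ Q) {N : ℕ}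
    {p : ℕ → ℝ} (hp : ∀ k, 0 ≤ p k) (hint : ∀ k, 0 < k → k < N → p k = p 1)
    (hend : 2 ≤ N → p 0 ≤ Q * p 1 ∧ p N ≤ Q * p 1) :
    |∑ k ∈ Finset.range (N + 1), p k * (ψ k - ∫ t in (0 : ℝ)..1, ψ (t * N))| ≤
      (2 * κ + √(κ * (8 * Q * B))) * ∑ k ∈ Finset.range (N + 1), p k := by
  set A := ∫ t in (0 : ℝ)..1, ψ (t * N) with hA
  set S := ∑ k ∈ Finset.range (N + 1), p k with hS
  have hκ : 0 ≤ κ := by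
    have := (abs_nonneg _).trans (hψ 1 0)
    simpa using this
  have hB0 : 0 ≤ B := (abs_nonneg _).trans (hB 0)
  have hS0 : 0 ≤ S := Finset.sum_nonneg fun k _ => hp k
  have hsqrt := Real.sqrt_nonneg (κ * (8 * Q * B))
  have hA' : |A| ≤ B := by
    have := intervalIntegral.norm_integral_le_of_norm_le_const (a := (0 : ℝ)) (b := 1) (C := B)
      (f := fun t => ψ (t * N)) fun t _ => hB _
    simpa [hA] using this
  have hd2 (k : ℕ) : |ψ k - A| ≤ 2 * B := by
    have h1 := abs_le.1 (hB k)
    have h2 := abs_le.1 hA'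
    rw [abs_le]
    constructor <;> linarith
  have hd1 (k : ℕ) (hk : k ∈ Finset.range (N + 1)) : |ψ k - A| ≤ κ * N := by
    have hkN : (k : ℝ) ≤ N := by exact_mod_cast Nat.lt_succ_iff.1 (Finset.mem_range.1 hk)
    have hc : Continuous fun t : ℝ => ψ (t * N) := hψc.comp (continuous_mul_const _)
    have h1 : ψ k - A = ∫ t in (0 : ℝ)..1, (ψ k - ψ (t * N)) := by
      rw [intervalIntegral.integral_sub (by simp) (hc.intervalIntegrable _ _)]
      simp [hA]
    rw [h1, ← Real.norm_eq_abs]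
    refine (intervalIntegral.norm_integral_le_of_norm_le_const (C := κ * N) fun t ht => ?_).trans
      (by simp)
    rw [Set.uIoc_of_le zero_le_one] at ht
    rw [Real.norm_eq_abs]
    refine (hψ _ _).trans (mul_le_mul_of_nonneg_left ?_ hκ)
    have hk0 : (0 : ℝ) ≤ k := Nat.cast_nonneg k
    have hN0 : (0 : ℝ) ≤ N := Nat.cast_nonneg N
    rw [abs_le]
    constructor <;> nlinarith [ht.1, ht.2]
  have hcrude : |∑ k ∈ Finset.range (N + 1), p k * (ψ k - A)| ≤ κ * N * S := by
    refine (Finset.abs_sum_le_sum_abs _ _).trans ?_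
    rw [hS, Finset.mul_sum]
    refine Finset.sum_le_sum fun k hk => ?_
    rw [abs_mul, abs_of_nonneg (hp k), mul_comm]
    exact mul_le_mul_of_nonneg_right (hd1 k hk) (hp k)
  rcases Nat.lt_or_ge N 2 with hN | hN
  · refine hcrude.trans (mul_le_mul_of_nonneg_right ?_ hS0)
    have : (N : ℝ) ≤ 1 := by exact_mod_cast Nat.lt_succ_iff.1 hN
    nlinarith
  -- The threshold balances the two estimates: below it the oscillation `κ * N` is small enough,
  -- above it the ends contribute at most `4 * Q * B * p 1`, negligible against the total mass `S ≥
  -- p 1 * N / 2`.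
  by_cases hcase : κ * N ≤ √(κ * (8 * Q * B))
  · exact hcrude.trans (mul_le_mul_of_nonneg_right (by linarith) hS0)
  obtain ⟨hp0, hpN⟩ := hend hN
  have hN2 : (2 : ℝ) ≤ N := by exact_mod_cast hN
  have hp1 := hp 1
  have hbulk := abs_sum_sub_integral_le hψc hψ N
  rw [← hA] at hbulk
  -- The bulk sum includes `k = 0` with weight `p 1`, which leaves the correction `p 0 - p 1` there.
  have hsplit {g : ℕ → ℝ} : ∑ k ∈ Finset.range (N + 1), p k * g k =
      p 1 * ∑ k ∈ Finset.range N, g k + (p 0 - p 1) * g 0 + p N * g N := by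
    have h1 : ∑ k ∈ Finset.range N, p k * g k =
        p 1 * ∑ k ∈ Finset.range N, g k + (p 0 - p 1) * g 0 := by
      obtain ⟨M, rfl⟩ : ∃ M, N = M + 1 := ⟨N - 1, by omega⟩
      rw [Finset.sum_range_succ', Finset.sum_range_succ', mul_add, Finset.mul_sum,
        Finset.sum_congr rfl fun k hk => by
          rw [hint (k + 1) k.succ_pos (by have := Finset.mem_range.1 hk; omega)]]
      ring
    rw [Finset.sum_range_succ, h1]
  have hSlow : p 1 * N ≤ 2 * S := by
    have h1 : S = p 1 * N + (p 0 - p 1) + p N := by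
      have := hsplit (g := fun _ => 1)
      simpa [hS] using this
    nlinarith [hp 0, hp N]
  have hfine : |∑ k ∈ Finset.range (N + 1), p k * (ψ k - A)| ≤ p 1 * (κ * N + 4 * Q * B) := by
    rw [hsplit]
    have h1 : |p 1 * ∑ k ∈ Finset.range N, (ψ k - A)| ≤ p 1 * (κ * N) := by
      rw [abs_mul, abs_of_nonneg hp1]
      exact mul_le_mul_of_nonneg_left hbulk hp1
    have h2 : |(p 0 - p 1) * (ψ (0 : ℕ) - A)| ≤ Q * p 1 * (2 * B) := by
      rw [abs_mul]
      refine mul_le_mul ?_ (hd2 0) (abs_nonneg _) (by positivity)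
      rw [abs_le]
      constructor <;> nlinarith [hp 0]
    have h3 : |p N * (ψ N - A)| ≤ Q * p 1 * (2 * B) := by
      rw [abs_mul, abs_of_nonneg (hp N)]
      exact mul_le_mul hpN (hd2 N) (abs_nonneg _) (by positivity)
    refine (abs_add_le _ _).trans ((add_le_add ((abs_add_le _ _).trans (add_le_add h1 h2)) h3).trans
      (le_of_eq (by ring)))
  set q := √(κ * (8 * Q * B)) with hq
  have hq2 : q * q = κ * (8 * Q * B) := Real.mul_self_sqrt (by positivity)
  have hκ0 : 0 < κ := by
    rcases hκ.eq_or_lt with h | h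
    · rw [← h, zero_mul] at hcase
      exact absurd hsqrt hcase
    · exact h
  have hqN : 8 * Q * B ≤ q * N := by
    have h1 : κ * (8 * Q * B) ≤ κ * (q * N) := by
      rw [← hq2]
      nlinarith
    exact le_of_mul_le_mul_left h1 hκ0
  refine hfine.trans ?_
  have h1 : p 1 * (κ * N + 4 * Q * B) ≤ p 1 * N * (κ + q / 2) := by nlinarith
  have h2 : p 1 * N * (κ + q / 2) ≤ 2 * S * (κ + q / 2) :=
    mul_le_mul_of_nonneg_right hSlow (by positivity)
  linarith

/-! ### Fibers of half-strict patterns over all entries but one -/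

namespace HalfStrictGT

variable {n : ℕ}

/-- Replace an entry by another one that lies strictly between the bounds. -/
def replace (m : HalfStrictGT n) (s : Site (Below (n := n))) (hs : s.idx.1.val + 1 < n) (c : ℤ)
    (h1 : s.lo m.entry < c) (h2 : c < s.hi m.entry) : HalfStrictGT n where
  entry := Function.update m.entry s.idx c
  strictMono k hk := by
    rcases k with _ | k
    · exact fun i => i.elim0
    refine Fin.strictMono_iff_lt_succ.2 fun i => ?_
    have hi := i.isLt
    have hm := m.strictMono (k + 1) hk i.castSucc_lt_succ
    set p : GTIndex n := ⟨⟨k, by omega⟩, ⟨i.val, by simp only; omega⟩⟩ with hp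
    set q : GTIndex n := ⟨⟨k, by omega⟩, ⟨i.val + 1, by simp only; omega⟩⟩ with hq
    have ep (e : GTIndex n → ℤ) : row e (k + 1) hk i.castSucc = e p := row_eq e _ _ rfl rfl
    have eq (e : GTIndex n → ℤ) : row e (k + 1) hk i.succ = e q := row_eq e _ _ rfl rfl
    rw [ep, eq] at hm ⊢
    by_cases hps : p = s.idx
    · have hqs : q ≠ s.idx := fun h => by
        have : i.val + 1 = i.val := congrArg (fun q : GTIndex n => q.2.val) (h.trans hps.symm)
        omega
      have hkn : k + 1 < n := by
        rw [← hps] at hs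
        exact hs
      -- Two consecutive entries of a row are separated by an entry `r` of the row above; since the
      -- new value is strictly off its bounds, strictness of the row survives. At an end of the
      -- range it may fail.
      set r : GTIndex n := ⟨⟨k + 1, hkn⟩, ⟨i.val + 1, by simp only; omega⟩⟩
      have hr1 : Below s.idx r := hps ▸ Or.inr ⟨rfl, rfl⟩
      have hr2 : Below r q := Or.inl ⟨rfl, rfl⟩
      rw [hps, Function.update_self, Function.update_of_ne hqs]
      exact h2.trans_le ((s.hi_le hr1).trans (m.mem_orderCone r q hr2))
    · rw [Function.update_of_ne hps]
      by_cases hqs : q = s.idx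
      · have hkn : k + 1 < n := by
          rw [← hqs] at hs
          exact hs
        set r : GTIndex n := ⟨⟨k + 1, hkn⟩, ⟨i.val + 1, by simp only; omega⟩⟩
        have hr1 : Below r s.idx := hqs ▸ Or.inl ⟨rfl, rfl⟩
        have hr2 : Below p r := Or.inr ⟨rfl, rfl⟩
        rw [hqs, Function.update_self]
        exact ((m.mem_orderCone p r hr2).trans (s.le_lo hr1)).trans_lt h1
      · rwa [Function.update_of_ne hqs]
  interlace := (gtCone_aux_iff _).2 (s.update_mem_orderCone m.mem_orderCone h1.le h2.le)
  nonneg i := by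
    have h : topRow (Function.update m.entry s.idx c) i = topRow m.entry i :=
      Function.update_of_ne (fun e => ?_) _ _
    · exact h ▸ m.nonneg i
    have h3 : n - 1 = s.idx.1.val := congrArg (fun q : GTIndex n => q.1.val) e
    omega

/-- The patterns that agree with `m₀` except possibly at one entry. -/
def fiber (m₀ : HalfStrictGT n) (s : Site (Below (n := n))) : Set (HalfStrictGT n) :=
  {m | ∀ p, p ≠ s.idx → m.entry p = m₀.entry p}

variable {s : Site (Below (n := n))}

theorem topRow_eq_of_mem_fiber {m₀ m : HalfStrictGT n} (hs : s.idx.1.val + 1 < n)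
    (hm : m ∈ m₀.fiber s) : topRow m.entry = topRow m₀.entry := by
  refine funext fun i => hm _ fun e => ?_
  have h3 : n - 1 = s.idx.1.val := congrArg (fun q : GTIndex n => q.1.val) e
  omega

theorem entry_eq_update_of_mem_fiber {m₀ m : HalfStrictGT n} (hm : m ∈ m₀.fiber s) :
    m.entry = Function.update m₀.entry s.idx (m.entry s.idx) := by
  ext p
  by_cases hp : p = s.idx
  · rw [hp, Function.update_self]
  · rw [Function.update_of_ne hp, hm p hp]

theorem rescale_eq_update_of_mem_fiber (a b : ℝ) {m₀ m : HalfStrictGT n} (hm : m ∈ m₀.fiber s) :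
    rescale a b m = Function.update (rescale a b m₀) s.idx (((m.entry s.idx : ℝ) - a) / b) := by
  ext p
  by_cases hp : p = s.idx
  · rw [hp, Function.update_self, rescale]
  · rw [Function.update_of_ne hp, rescale, rescale, hm p hp]

theorem lo_rescale (a : ℝ) {b : ℝ} (hb : 0 < b) (m : HalfStrictGT n) :
    s.lo (rescale a b m) = (((s.lo m.entry : ℤ) : ℝ) - a) / b := by
  refine s.lo_comp (g := fun z : ℤ => ((z : ℝ) - a) / b) (fun x y h => ?_) m.entry
  have : (x : ℝ) ≤ y := Int.cast_le.2 h
  simp only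
  gcongr

theorem hi_rescale (a : ℝ) {b : ℝ} (hb : 0 < b) (m : HalfStrictGT n) :
    s.hi (rescale a b m) = (((s.hi m.entry : ℤ) : ℝ) - a) / b := by
  refine s.hi_comp (g := fun z : ℤ => ((z : ℝ) - a) / b) (fun x y h => ?_) m.entry
  have : (x : ℝ) ≤ y := Int.cast_le.2 h
  simp only
  gcongr

/-- The patterns in the fiber of `m₀` whose free entry exceeds its lower bound by `k`. -/
def fiberAt (m₀ : HalfStrictGT n) (s : Site (Below (n := n))) (k : ℕ) : Set (HalfStrictGT n) :=
  {m | m ∈ m₀.fiber s ∧ m.entry s.idx = s.lo m₀.entry + k}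

theorem eq_of_mem_fiberAt {m₀ m m' : HalfStrictGT n} {k : ℕ} (hm : m ∈ m₀.fiberAt s k)
    (hm' : m' ∈ m₀.fiberAt s k) : m = m' := by
  refine entry_injective ?_
  rw [entry_eq_update_of_mem_fiber hm.1, entry_eq_update_of_mem_fiber hm'.1, hm.2, hm'.2]

theorem fiber_eq_biUnion (m₀ : HalfStrictGT n) :
    m₀.fiber s = ⋃ k ∈ Finset.range ((s.hi m₀.entry - s.lo m₀.entry).toNat + 1),
      m₀.fiberAt s k := by
  ext m
  simp only [Set.mem_iUnion, Finset.mem_range, exists_prop]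
  constructor
  · intro hm
    have h1 := s.lo_le m.mem_orderCone
    have h2 := s.le_hi m.mem_orderCone
    rw [s.lo_congr hm] at h1
    rw [s.hi_congr hm] at h2
    exact ⟨(m.entry s.idx - s.lo m₀.entry).toNat, by omega, hm, by omega⟩
  · rintro ⟨k, -, hm⟩
    exact hm.1

/-- On a fiber the continuous average is constant and the integral is a finite sum over the values
of the free entry. Interior values all occur and have equal mass, so the one-dimensional estimate
applies with `κ = L / b` and `Q = max 1 (c₂ / c₁)`. -/
theorem abs_setIntegral_fiber_le {w : Fin 6 → ℝ} (hw : ∀ r, 0 < w r) {c₁ c₂ : ℝ} (hc₁ : 0 < c₁)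
    (hc : ∀ m : HalfStrictGT n, c₁ ≤ m.weight w ∧ m.weight w ≤ c₂)
    {ρ : Measure (HalfStrictGT n)} [IsFiniteMeasure ρ] (hρ : SixVertexGibbs w ρ)
    (hs : s.idx.1.val + 1 < n) (a : ℝ) {b : ℝ} (hb : 0 < b) {f : (GTIndex n → ℝ) → ℝ}
    {L : NNReal} (hf : LipschitzWith L f) {B : ℝ} (hB : ∀ y, |f y| ≤ B) (m₀ : HalfStrictGT n) :
    |∫ m in m₀.fiber s, (f (rescale a b m) - s.average f (rescale a b m)) ∂ρ| ≤
      (2 * (L / b) + √(L / b * (8 * max 1 (c₂ / c₁) * B))) * ρ.real (m₀.fiber s) := by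
  obtain ⟨K, hK0, hK⟩ := exists_measureReal_singleton_eq hw hρ (topRow m₀.entry)
  set N := (s.hi m₀.entry - s.lo m₀.entry).toNat with hN
  have hNcast : ((N : ℤ) : ℝ) = ((s.hi m₀.entry : ℤ) : ℝ) - (s.lo m₀.entry : ℤ) := by
    have h1 := (s.lo_le m₀.mem_orderCone).trans (s.le_hi m₀.mem_orderCone)
    rw [hN, Int.toNat_of_nonneg (by omega)]
    push_cast
    rfl
  rw [Int.cast_natCast] at hNcast
  set ψ : ℝ → ℝ := fun u => f (Function.update (rescale a b m₀) s.idx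
    ((((s.lo m₀.entry : ℤ) : ℝ) + u - a) / b)) with hψ
  have hψc : Continuous ψ := hf.continuous.comp
    (continuous_const.update s.idx (by fun_prop))
  have hψL (u v : ℝ) : |ψ u - ψ v| ≤ L / b * |u - v| := by
    rw [← Real.dist_eq]
    refine (hf.dist_le_mul _ _).trans ?_
    rw [div_mul_eq_mul_div, mul_div_assoc]
    refine mul_le_mul_of_nonneg_left ?_ L.coe_nonneg
    refine (dist_pi_le_iff (by positivity)).2 fun p => ?_
    by_cases hp : p = s.idx
    · subst hp
      rw [Function.update_self, Function.update_self, Real.dist_eq, ← sub_div, abs_div,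
        abs_of_pos hb]
      exact le_of_eq (by congr 2; ring)
    · rw [Function.update_of_ne hp, Function.update_of_ne hp, dist_self]
      positivity
  have havg (m : HalfStrictGT n) (hm : m ∈ m₀.fiber s) :
      s.average f (rescale a b m) = ∫ t in (0 : ℝ)..1, ψ (t * N) := by
    refine intervalIntegral.integral_congr fun t _ => ?_
    simp only [hψ, Site.resample, lo_rescale a hb, hi_rescale a hb, s.lo_congr hm, s.hi_congr hm]
    rw [rescale_eq_update_of_mem_fiber a b hm, Function.update_idem, hNcast]
    congr 2
    field_simp
    ring
  have hval (k : ℕ) (m : HalfStrictGT n) (hm : m ∈ m₀.fiberAt s k) : f (rescale a b m) = ψ k := by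
    rw [rescale_eq_update_of_mem_fiber a b hm.1, hm.2]
    simp [hψ]
  set p : ℕ → ℝ := fun k => ρ.real (m₀.fiberAt s k) with hp
  have hdisj : (Finset.range (N + 1) : Set ℕ).PairwiseDisjoint (m₀.fiberAt s) := by
    intro k _ k' _ hkk'
    refine Set.disjoint_left.2 fun m hm hm' => hkk' ?_
    have := hm.2.symm.trans hm'.2
    omega
  have hsum : ρ.real (m₀.fiber s) = ∑ k ∈ Finset.range (N + 1), p k := by
    rw [fiber_eq_biUnion, measureReal_biUnion_finset hdisj fun _ _ => MeasurableSet.of_discrete]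
  have hintegral : ∫ m in m₀.fiber s, (f (rescale a b m) - s.average f (rescale a b m)) ∂ρ =
      ∑ k ∈ Finset.range (N + 1), p k * (ψ k - ∫ t in (0 : ℝ)..1, ψ (t * N)) := by
    have hint : Integrable (fun m => f (rescale a b m) - s.average f (rescale a b m)) ρ := by
      refine Integrable.of_bound (Measurable.of_discrete).aestronglyMeasurable (B + B)
        (Eventually.of_forall fun m => (norm_sub_le _ _).trans (add_le_add (hB _) ?_))
      exact s.norm_average_le (fun y => hB y) _
    rw [fiber_eq_biUnion, integral_biUnion_finset _ (fun _ _ => MeasurableSet.of_discrete) hdisj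
      fun _ _ => hint.integrableOn]
    refine Finset.sum_congr rfl fun k _ => ?_
    rw [setIntegral_congr_fun (g := fun _ => ψ k - ∫ t in (0 : ℝ)..1, ψ (t * N))
      MeasurableSet.of_discrete fun m hm => by simp only [hval k m hm, havg m hm.1],
      setIntegral_const, smul_eq_mul]
  have hle (k : ℕ) : p k ≤ K * c₂ := by
    rcases Set.eq_empty_or_nonempty (m₀.fiberAt s k) with he | ⟨m, hm⟩
    · simp only [hp, he, measureReal_empty]
      exact mul_nonneg hK0 (hc₁.le.trans ((hc m₀).1.trans (hc m₀).2))
    · have he : m₀.fiberAt s k = {m} :=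
        Set.eq_singleton_iff_unique_mem.2 ⟨hm, fun m' hm' => eq_of_mem_fiberAt hm' hm⟩
      simp only [hp, he, hK m (topRow_eq_of_mem_fiber hs hm.1)]
      exact mul_le_mul_of_nonneg_left (hc m).2 hK0
  have hinterior (k : ℕ) (h1 : 0 < k) (h2 : k < N) : ∃ m : HalfStrictGT n, m ∈ m₀.fiberAt s k ∧
      m.Interior s ∧ p k = K * m.weight w := by
    have h3 : s.lo m₀.entry < s.lo m₀.entry + k := by omega
    have h4 : s.lo m₀.entry + k < s.hi m₀.entry := by omega
    have hfib : m₀.replace s hs _ h3 h4 ∈ m₀.fiberAt s k :=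
      ⟨fun q hq => Function.update_of_ne hq _ _, Function.update_self ..⟩
    refine ⟨_, hfib, ⟨?_, ?_⟩, ?_⟩
    · rw [s.lo_congr hfib.1, hfib.2]
      exact h3
    · rw [s.hi_congr hfib.1, hfib.2]
      exact h4
    · rw [← hK _ (topRow_eq_of_mem_fiber hs hfib.1), ← Set.eq_singleton_iff_unique_mem.2
        ⟨hfib, fun m' hm' => eq_of_mem_fiberAt hm' hfib⟩]
  rw [hintegral, hsum]
  refine abs_sum_mul_sub_integral_le hψc hψL (fun u => hB _) (le_max_left _ _)
    (fun k => measureReal_nonneg) (fun k h1 h2 => ?_) fun h2 => ?_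
  · obtain ⟨m, hm, hmi, e⟩ := hinterior k h1 h2
    obtain ⟨m', hm', hmi', e'⟩ := hinterior 1 one_pos (by omega)
    rw [e, e', weight_eq_of_interior w (fun q hq => (hm.1 q hq).trans (hm'.1 q hq).symm) hmi hmi']
  · obtain ⟨m', hm', hmi', e'⟩ := hinterior 1 one_pos (by omega)
    -- An end value may belong to no pattern or to one with coincidences; in either case its mass is
    -- at most `K * c₂`, while `p 1` is at least `K * c₁`.
    have hQ : K * c₂ ≤ max 1 (c₂ / c₁) * p 1 := by
      have h3 : c₂ / c₁ * p 1 ≤ max 1 (c₂ / c₁) * p 1 :=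
        mul_le_mul_of_nonneg_right (le_max_right _ _) measureReal_nonneg
      refine le_trans ?_ h3
      have hc₂ : 0 ≤ c₂ := hc₁.le.trans ((hc m₀).1.trans (hc m₀).2)
      calc K * c₂ = c₂ / c₁ * (K * c₁) := by field_simp
        _ ≤ c₂ / c₁ * p 1 := by
          rw [e']
          exact mul_le_mul_of_nonneg_left (mul_le_mul_of_nonneg_left (hc m').1 hK0)
            (div_nonneg hc₂ hc₁.le)
    exact ⟨(hle 0).trans hQ, (hle N).trans hQ⟩

theorem abs_integral_sub_average_le {w : Fin 6 → ℝ} (hw : ∀ r, 0 < w r) {c₁ c₂ : ℝ} (hc₁ : 0 < c₁)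
    (hc : ∀ m : HalfStrictGT n, c₁ ≤ m.weight w ∧ m.weight w ≤ c₂)
    {ρ : Measure (HalfStrictGT n)} [IsProbabilityMeasure ρ] (hρ : SixVertexGibbs w ρ)
    (hs : s.idx.1.val + 1 < n) (a : ℝ) {b : ℝ} (hb : 0 < b) {f : (GTIndex n → ℝ) → ℝ}
    {L : NNReal} (hf : LipschitzWith L f) {B : ℝ} (hB : ∀ y, |f y| ≤ B) :
    |∫ m, (f (rescale a b m) - s.average f (rescale a b m)) ∂ρ| ≤
      2 * (L / b) + √(L / b * (8 * max 1 (c₂ / c₁) * B)) := by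
  set E := 2 * (L / b) + √(L / b * (8 * max 1 (c₂ / c₁) * B))
  set F : HalfStrictGT n → ℝ := fun m => f (rescale a b m) - s.average f (rescale a b m)
  have hint : Integrable F ρ := by
    refine Integrable.of_bound (Measurable.of_discrete).aestronglyMeasurable (B + B)
      (Eventually.of_forall fun m => (norm_sub_le _ _).trans (add_le_add (hB _) ?_))
    exact s.norm_average_le (fun y => hB y) _
  -- The fibers of `r` form a countable partition; as the fiber bounds are `E` times the fiber
  -- masses, they add up to `E`.
  let r : HalfStrictGT n → ({p : GTIndex n // p ≠ s.idx} → ℤ) := fun m p => m.entry p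
  have huniv : (⋃ t, r ⁻¹' {t}) = Set.univ := by
    ext m
    simp
  have hdisj : Pairwise (Function.onFun Disjoint fun t => r ⁻¹' {t}) := fun t t' h =>
    Disjoint.preimage r (Set.disjoint_singleton.2 h)
  have hmeas (t) : MeasurableSet (r ⁻¹' {t}) := MeasurableSet.of_discrete
  have hfib (t) : ‖∫ m in r ⁻¹' {t}, F m ∂ρ‖ ≤ E * ρ.real (r ⁻¹' {t}) := by
    rw [Real.norm_eq_abs]
    rcases Set.eq_empty_or_nonempty (r ⁻¹' {t}) with he | ⟨m₀, hm₀⟩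
    · simp [he]
    · have he : r ⁻¹' {t} = m₀.fiber s := by
        ext m
        rw [Set.mem_preimage, Set.mem_singleton_iff, ← (hm₀ : r m₀ = t), funext_iff]
        exact ⟨fun h p hp => h ⟨p, hp⟩, fun h p => h p.1 p.2⟩
      rw [he]
      exact abs_setIntegral_fiber_le hw hc₁ hc hρ hs a hb hf hB m₀
  have h1 : HasSum (fun t => ∫ m in r ⁻¹' {t}, F m ∂ρ) (∫ m, F m ∂ρ) := by
    have := hasSum_integral_iUnion hmeas hdisj (hint.integrableOn (s := ⋃ t, r ⁻¹' {t}))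
    rwa [huniv, setIntegral_univ] at this
  have h2 : HasSum (fun t => E * ρ.real (r ⁻¹' {t})) E := by
    have := hasSum_integral_iUnion hmeas hdisj
      ((integrable_const (μ := ρ) E).integrableOn (s := ⋃ t, r ⁻¹' {t}))
    rw [huniv, setIntegral_univ] at this
    simpa [mul_comm] using this
  have h3 := tsum_of_norm_bounded h2 hfib
  rwa [h1.tsum_eq] at h3

end HalfStrictGT

/-! ### Passage to the scaling limit -/

/-- A weak limit of rescaled six-vertex Gibbs measures is invariant under resampling. -/
theorem invariant_of_tendsto {n : ℕ} {w : Fin 6 → ℝ} (hw : ∀ r, 0 < w r)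
    {ρ : ℕ → ProbabilityMeasure (HalfStrictGT n)}
    (hρ : ∀ k, SixVertexGibbs w (ρ k : Measure (HalfStrictGT n)))
    {a b : ℕ → ℝ} (hb : Tendsto b atTop atTop) {μ : ProbabilityMeasure (GTIndex n → ℝ)}
    (hlim : Tendsto (fun k => rescaledLaw (a k) (b k) (ρ k)) atTop (𝓝 μ))
    {s : Site (Below (n := n))} (hs : s.idx.1.val + 1 < n) :
    s.Invariant (μ : Measure (GTIndex n → ℝ)) := by
  obtain ⟨c₁, c₂, hc₁, hc⟩ := HalfStrictGT.exists_weight_bounds hw n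
  have : IsProbabilityMeasure (volume.restrict (Set.Ioc (0 : ℝ) 1)) := ⟨by simp⟩
  obtain ⟨μ', hμ'⟩ : ∃ μ' : ProbabilityMeasure (GTIndex n → ℝ), (μ' : Measure (GTIndex n → ℝ)) =
      ((μ : Measure (GTIndex n → ℝ)).prod (volume.restrict (Set.Ioc (0 : ℝ) 1))).map
        (fun z => s.resample z.1 z.2) :=
    ⟨⟨_, Measure.isProbabilityMeasure_map s.continuous_resample.measurable.aemeasurable⟩, rfl⟩
  -- Phrasing the equality of two measures as convergence of a constant sequence makes bounded
  -- Lipschitz test functions suffice.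
  suffices h : Tendsto (fun _ : ℕ => μ) atTop (𝓝 μ') by
    have e : μ = μ' := tendsto_nhds_unique tendsto_const_nhds h
    rw [Site.Invariant, ← hμ', ← e]
  rw [tendsto_iff_forall_lipschitz_integral_tendsto]
  rintro f ⟨C, hC⟩ ⟨L, hL⟩
  set B := |f 0| + C
  have hB (y) : |f y| ≤ B := by
    have h1 := hC y 0
    rw [Real.dist_eq] at h1
    have h2 := abs_add_le (f y - f 0) (f 0)
    rw [sub_add_cancel] at h2
    linarith
  have havg : ∫ y, f y ∂(μ' : Measure (GTIndex n → ℝ)) =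
      ∫ y, s.average f y ∂(μ : Measure (GTIndex n → ℝ)) := by
    rw [hμ']
    exact s.integral_resample hL.continuous hB _
  have htend (g : (GTIndex n → ℝ) → ℝ) (hg : Continuous g) (hgB : ∀ y, ‖g y‖ ≤ B) :
      Tendsto (fun k => ∫ m, g (rescale (a k) (b k) m) ∂(ρ k : Measure (HalfStrictGT n))) atTop
        (𝓝 (∫ y, g y ∂(μ : Measure (GTIndex n → ℝ)))) := by
    have h := ProbabilityMeasure.tendsto_iff_forall_integral_tendsto.1 hlim
      (BoundedContinuousFunction.ofNormedAddCommGroup g hg B hgB)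
    refine h.congr fun k => ?_
    rw [rescaledLaw, ProbabilityMeasure.toMeasure_map,
      integral_map Measurable.of_discrete.aemeasurable]
    · rfl
    · exact hg.aestronglyMeasurable
  have hint (k : ℕ) (g : (GTIndex n → ℝ) → ℝ) (hgB : ∀ y, ‖g y‖ ≤ B) :
      Integrable (fun m => g (rescale (a k) (b k) m)) (ρ k : Measure (HalfStrictGT n)) :=
    Integrable.of_bound (Measurable.of_discrete).aestronglyMeasurable B
      (Eventually.of_forall fun m => hgB _)
  -- Both `f` and its average are bounded and continuous, so weak convergence applies to each of
  -- them.
  have hdiff := (htend f hL.continuous hB).sub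
    (htend (s.average f) (s.continuous_average hL.continuous) (s.norm_average_le hB))
  have hzero : Tendsto (fun k => ∫ m, f (rescale (a k) (b k) m) ∂(ρ k : Measure (HalfStrictGT n)) -
      ∫ m, s.average f (rescale (a k) (b k) m) ∂(ρ k : Measure (HalfStrictGT n))) atTop (𝓝 0) := by
    have hκ : Tendsto (fun k => (L : ℝ) / b k) atTop (𝓝 0) := hb.const_div_atTop _
    have hE : Tendsto (fun k => 2 * ((L : ℝ) / b k) +
        √(L / b k * (8 * max 1 (c₂ / c₁) * B))) atTop (𝓝 0) := by
      have := (hκ.const_mul 2).add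
        (Real.continuous_sqrt.tendsto _ |>.comp (hκ.mul_const (8 * max 1 (c₂ / c₁) * B)))
      simpa using this
    refine squeeze_zero_norm' ?_ hE
    filter_upwards [hb.eventually_gt_atTop 0] with k hk
    rw [← integral_sub (hint k f hB) (hint k _ (s.norm_average_le hB))]
    exact HalfStrictGT.abs_integral_sub_average_le hw hc₁ hc (hρ k) hs (a k) hk hL hB
  have heq := sub_eq_zero.1 (tendsto_nhds_unique hdiff hzero)
  rw [havg, ← heq]
  exact tendsto_const_nhds

end SixVertexGT

theorem proposition6p5 (n : ℕ) (w : Fin 6 → ℝ) (hw : ∀ r, 0 < w r)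
    (ρ : ℕ → ProbabilityMeasure (HalfStrictGT n))
    (hρ : ∀ k, SixVertexGibbs w (ρ k : Measure (HalfStrictGT n)))
    (a b : ℕ → ℝ) (hb : Tendsto b atTop atTop)
    (μ : ProbabilityMeasure (GTIndex n → ℝ))
    (hμ : ∀ᵐ y ∂(μ : Measure (GTIndex n → ℝ)), y ∈ gtCone n)
    (hlim : Tendsto (fun k => rescaledLaw (a k) (b k) (ρ k)) atTop (𝓝 μ))
    (htriple : (μ : Measure (GTIndex n → ℝ))
      {y | ∃ (i : ℕ) (hi : i + 2 < n),
        topRow y ⟨i, by omega⟩ = topRow y ⟨i + 1, by omega⟩ ∧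
          topRow y ⟨i + 1, by omega⟩ = topRow y ⟨i + 2, hi⟩} = 0) :
    ContinuousGibbs (μ : Measure (GTIndex n → ℝ)) := by
  exact continuousGibbs_of_invariant _ hμ fun _ hs => invariant_of_tendsto hw hρ hb hlim hs
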